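/- Let $K$ be a field, $S=K[x_1,\dots,x_n]$ the standard graded polynomial ring, and $I\subset S$ a monomial ideal. The following are equivalent: (1) There are a subset $V$ of the set of variables, a tree $G$ with vertex set $V$ and non-empty edge set $E$, and a map $\phi:Q\to E$, where $Q$ is the set of the variables not in $V$, such that $I=I(G,\phi)$. (2) $S/I$ is a Cohen-Macaulay ring of Krull dimension $2$ with minimal multiplicity. Here $I(G,\phi)=J+H$, where $J$ is the ideal of $S$ generated by the products $xy$ of distinct $x,y\in V$ with $\{x,y\}\notin E$ and by the products $xyz$ of pairwise distinct $x,y,z\in V$, and $H=(Q)^2+(xy : x\in Q,\ y\in V,\ y\notin\phi(x))$. The ring $S/I$ has minimal multiplicity if $I$ contains no non-zero linear form and $e(S/I)=c+1$, where $c=\dim S-\dim S/I$ is the codimension of $I$ and $e(S/I)=h(1)$ for the polynomial $h(z)\in\mathbb{Z}[z]$ with $\sum_{i\ge 0}\dim_K(S/I)_i\,z^i=h(z)/(1-z)^{\dim S/I}$. -/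

import Mathlib

noncomputable section

namespace MonomialTrees

open MvPolynomial

/-! ### Cohen-Macaulay rings -/

/-- A (Noetherian) local ring is Cohen-Macaulay if its maximal ideal contains a regular sequence
whose length is the Krull dimension of the ring. -/
def IsCohenMacaulayLocal (R : Type*) [CommRing R] [IsLocalRing R] : Prop :=
  ∃ rs : List R, (∀ r ∈ rs, r ∈ IsLocalRing.maximalIdeal R) ∧
    RingTheory.Sequence.IsRegular R rs ∧ ((rs.length : ℕ) : WithBot ℕ∞) = ringKrullDim R

/-- A commutative ring is Cohen-Macaulay if it is Noetherian and its localization at every maximal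
ideal is a Cohen-Macaulay local ring. -/
def IsCohenMacaulay (R : Type*) [CommRing R] : Prop :=
  IsNoetherianRing R ∧ ∀ (p : Ideal R) [p.IsMaximal], IsCohenMacaulayLocal (Localization.AtPrime p)

/-! ### Hilbert series, multiplicity, minimal multiplicity -/

section Hilbert

variable {σ K : Type*} [Field K]

/-- The degree `i` component of `S/I` for a homogeneous ideal `I` of the polynomial ring `S` with
its standard grading: the image in `S/I` of the space of forms of degree `i`. -/
def gradedPart (I : Ideal (MvPolynomial σ K)) (i : ℕ) : Submodule K (MvPolynomial σ K ⧸ I) :=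
  (homogeneousSubmodule σ K i).map (Ideal.Quotient.mkₐ K I).toLinearMap

/-- The Hilbert series `∑ dim_K (S/I)_i z^i`. -/
def hilbertSeries (I : Ideal (MvPolynomial σ K)) : PowerSeries ℤ :=
  PowerSeries.mk fun i => (Module.finrank K (gradedPart I i) : ℤ)

/-- `h` is the `h`-polynomial of `S/I`: the Hilbert series of `S/I` is `h(z)/(1-z)^d`, with `d` the
Krull dimension of `S/I`. -/
def IsHPolynomial (I : Ideal (MvPolynomial σ K)) (h : Polynomial ℤ) : Prop :=
  ∃ d : ℕ, ringKrullDim (MvPolynomial σ K ⧸ I) = d ∧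
    hilbertSeries I * (1 - PowerSeries.X) ^ d = (h : PowerSeries ℤ)

/-- The multiplicity of `S/I` is `e`, that is, `e = h(1)` for the `h`-polynomial `h` of `S/I`. -/
def HasMultiplicity (I : Ideal (MvPolynomial σ K)) (e : ℤ) : Prop :=
  ∃ h : Polynomial ℤ, IsHPolynomial I h ∧ h.eval 1 = e

/-- The ideal `I` of `S` has codimension `c`, that is, `dim S = dim S/I + c`. -/
def HasCodimension (I : Ideal (MvPolynomial σ K)) (c : ℕ) : Prop :=
  ringKrullDim (MvPolynomial σ K) = ringKrullDim (MvPolynomial σ K ⧸ I) + c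

/-- `S/I` has minimal multiplicity: `I` contains no (nonzero) linear form and the multiplicity of
`S/I` is `c + 1`, with `c` the codimension of `I`. -/
def HasMinimalMultiplicity (I : Ideal (MvPolynomial σ K)) : Prop :=
  (∀ f ∈ I, f.IsHomogeneous 1 → f = 0) ∧
    ∃ c : ℕ, HasCodimension I c ∧ HasMultiplicity I (c + 1)

end Hilbert

/-! ### Monomial ideals, and the ideals attached to graphs and trees -/

section Ideals

variable {σ : Type*} (K : Type*) [Field K]

variable {K} in
/-- A monomial ideal: an ideal generated by monomials. -/
def IsMonomialIdeal (I : Ideal (MvPolynomial σ K)) : Prop :=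
  ∃ A : Set (σ →₀ ℕ), I = Ideal.span ((fun a => monomial a (1 : K)) '' A)

/-- The square-free monomial ideal (extended to the polynomial ring in all variables `σ`) of a graph
on a set `V` of variables: it is generated by the products `xy` of distinct non-adjacent vertices
and by the square-free monomials of degree `3` in the vertices. -/
def graphIdeal {V : Set σ} (G : SimpleGraph V) : Ideal (MvPolynomial σ K) :=
  Ideal.span ({f | ∃ x y : V, x ≠ y ∧ ¬ G.Adj x y ∧ f = X (x : σ) * X (y : σ)} ∪
    {f | ∃ x y z : V, x ≠ y ∧ x ≠ z ∧ y ≠ z ∧ f = X (x : σ) * X (y : σ) * X (z : σ)})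

/-- The ideal `H = (Q)² + (xy : x ∈ Q, y ∈ V, y ∉ φ(x))`, where `Q` is the complement of `V`. -/
def extraIdeal {V : Set σ} (G : SimpleGraph V) (φ : (Vᶜ : Set σ) → G.edgeSet) :
    Ideal (MvPolynomial σ K) :=
  Ideal.span ((fun q : σ => (X q : MvPolynomial σ K)) '' Vᶜ) ^ 2 ⊔
    Ideal.span {f | ∃ (x : (Vᶜ : Set σ)) (y : V),
      y ∉ (φ x : Sym2 V) ∧ f = X (x : σ) * X (y : σ)}

/-- The ideal `I(G, φ) = J + H`. -/
def treeIdeal {V : Set σ} (G : SimpleGraph V) (φ : (Vᶜ : Set σ) → G.edgeSet) :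
    Ideal (MvPolynomial σ K) :=
  graphIdeal K G ⊔ extraIdeal K G φ

end Ideals

end MonomialTrees

end

/-! The monomials outside `I` form a lower set `L` of exponents, and both directions are read off
from the coordinate cones `u + ℕ^T` contained in `L` (`IsCone`). Write `n` for the number of
variables and `c = n - 2` for the codimension.

From the ring to the tree: the Cohen-Macaulay property at the origin gives a regular pair inside the
ideal of the variables. Depth two excludes associated primes of dimension at most one there, so
every `u ∈ L` has a cone `u + ℕ^{x,y} ⊆ L` (`IsMonomialIdeal.exists_isCone`). Hartshorne's argument
shows that the graph of the pairs with `ℕ^{x,y} ⊆ L` is connected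
(`IsMonomialIdeal.preconnected_faceGraph`). Distinct plane cones whose base point vanishes on their
two directions are at most `e(S/I) = c + 1` in number (`IsMonomialIdeal.card_le_eval_one`). Each
edge gives such a cone at `0`, each variable `q ∈ Q` gives one at `e_q`, and connectedness gives
`|E| + |Q| ≥ |V| - 1 + |Q| = c + 1`. So equality holds: the graph is a tree, there are no other
cones, and `L` is the set of standard exponents of `I(G, φ)`.

From the tree to the ring: `L` arises from the plane of one edge by adding `n - 2` shifted planes
`e_a + ℕ^T` with `T` an edge (`coneChain_treeExponents`). Each addition is an exact sequence whose
kernel is a shifted copy of a polynomial ring in two variables. Hence the Hilbert function is `i + 1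
+ (n - 2) i`, and a pair regular on all edge planes is regular on `S/I`. A tree is bipartite; the
sums of the two colour classes restrict to the two variables of any edge, and polynomials in these
sums give regular sequences at all maximal ideals. -/

noncomputable section

namespace MonomialTrees

open MvPolynomial

/-! ### Standard monomials, the Hilbert function and bounds on the dimension of a monomial quotient.
-/

section

variable {σ K : Type*} [Field K]

/-- The exponents of the monomials outside `I`. -/
def standardExponents (I : Ideal (MvPolynomial σ K)) : Set (σ →₀ ℕ) :=
  {m | monomial m (1 : K) ∉ I}

lemma monomial_mem_of_le {I : Ideal (MvPolynomial σ K)} {m m' : σ →₀ ℕ} (h : m ≤ m')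
    (hm : monomial m (1 : K) ∈ I) (c : K) : monomial m' c ∈ I := by
  have : monomial m' c = monomial (m' - m) c * monomial m (1 : K) := by
    rw [monomial_mul, mul_one, tsub_add_cancel_of_le h]
  rw [this]
  exact I.mul_mem_left _ hm

lemma isLowerSet_standardExponents (I : Ideal (MvPolynomial σ K)) :
    IsLowerSet (standardExponents I) :=
  fun _ _ h hm h' => hm (monomial_mem_of_le h h' 1)

/-- A monomial ideal contains each term of each of its elements; hence the standard exponents
determine it. -/
lemma IsMonomialIdeal.mem_iff {I : Ideal (MvPolynomial σ K)} (hI : IsMonomialIdeal I)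
    {s : MvPolynomial σ K} : s ∈ I ↔ ∀ m ∈ s.support, m ∉ standardExponents I := by
  obtain ⟨A, rfl⟩ := hI
  simp only [standardExponents, Set.mem_ofPred_eq, not_not]
  rw [mem_ideal_span_monomial_image]
  refine forall₂_congr fun m _ => ?_
  rw [mem_ideal_span_monomial_image]
  classical
  simp [support_monomial]

lemma IsMonomialIdeal.coeff_eq_zero {I : Ideal (MvPolynomial σ K)} (hI : IsMonomialIdeal I)
    {s : MvPolynomial σ K} (hs : s ∈ I) {m : σ →₀ ℕ} (hm : m ∈ standardExponents I) :
    coeff m s = 0 := by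
  by_contra h
  exact hI.mem_iff.1 hs m (mem_support_iff.2 h) hm

lemma IsMonomialIdeal.ext {I J : Ideal (MvPolynomial σ K)} (hI : IsMonomialIdeal I)
    (hJ : IsMonomialIdeal J) (h : standardExponents I = standardExponents J) : I = J := by
  ext s
  rw [hI.mem_iff, hJ.mem_iff, h]

lemma IsMonomialIdeal.linearIndependent_mk {I : Ideal (MvPolynomial σ K)} (hI : IsMonomialIdeal I)
    (i : ℕ) :
    LinearIndependent K (fun m : {m // m ∈ standardExponents I ∧ m.degree = i} =>
      Ideal.Quotient.mkₐ K I (monomial m.1 (1 : K))) := by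
  classical
  rw [linearIndependent_iff']
  intro t g hg m hm
  have h1 : (∑ m ∈ t, monomial m.1 (g m) : MvPolynomial σ K) ∈ I := by
    rw [← Ideal.Quotient.eq_zero_iff_mem, ← hg, map_sum]
    refine Finset.sum_congr rfl fun m _ => ?_
    rw [← map_smul, smul_monomial, smul_eq_mul, mul_one]
    rfl
  have h2 := hI.coeff_eq_zero h1 m.2.1
  rw [coeff_sum, Finset.sum_eq_single m] at h2
  · simpa using h2
  · intro b _ hb
    rw [coeff_monomial, if_neg]
    exact fun h => hb (Subtype.ext h)
  · exact fun h => (h hm).elim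

lemma finite_degree_eq [Finite σ] (i : ℕ) : {m : σ →₀ ℕ | m.degree = i}.Finite := by
  classical
  have := Fintype.ofFinite σ
  refine (Finset.finite_toSet (Finset.finsuppAntidiag (Finset.univ : Finset σ) i)).subset ?_
  intro m hm
  simp only [Finset.mem_coe, Finset.mem_finsuppAntidiag, Finset.subset_univ, and_true]
  rw [← Finsupp.degree_eq_sum]
  exact hm

/-- The number of standard monomials of degree `i`. -/
def standardCount (L : Set (σ →₀ ℕ)) (i : ℕ) : ℕ := {m | m ∈ L ∧ m.degree = i}.ncard

/-- The classes of the standard monomials of degree `i` form a basis of the graded part. -/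
lemma IsMonomialIdeal.finrank_gradedPart [Finite σ] {I : Ideal (MvPolynomial σ K)}
    (hI : IsMonomialIdeal I) (i : ℕ) :
    Module.finrank K (gradedPart I i) = standardCount (standardExponents I) i := by
  have hfin : {m | m ∈ standardExponents I ∧ m.degree = i}.Finite :=
    (finite_degree_eq i).subset fun m hm => hm.2
  have : Fintype {m // m ∈ standardExponents I ∧ m.degree = i} := hfin.fintype
  have h := finrank_span_eq_card (hI.linearIndependent_mk i)
  rw [standardCount, Set.ncard_eq_toFinset_card _ hfin, ← Nat.card_eq_card_finite_toFinset,
    Set.coe_ofPred, Nat.card_eq_fintype_card, ← h]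
  suffices gradedPart I i = Submodule.span K (Set.range
      (fun m : {m // m ∈ standardExponents I ∧ m.degree = i} =>
      Ideal.Quotient.mkₐ K I (monomial m.1 (1 : K)))) by rw [this]
  apply le_antisymm
  · rw [gradedPart, homogeneousSubmodule_eq_finsupp_supported, Submodule.map_le_iff_le_comap]
    change restrictSupport K _ ≤ _
    rw [restrictSupport_eq_span, Submodule.span_le]
    rintro _ ⟨m, hm, rfl⟩
    by_cases h : m ∈ standardExponents I
    · exact Submodule.subset_span ⟨⟨m, h, hm⟩, rfl⟩
    · have : Ideal.Quotient.mkₐ K I (monomial m (1 : K)) = 0 :=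
        Ideal.Quotient.eq_zero_iff_mem.2 (not_not.1 h)
      change Ideal.Quotient.mkₐ K I (monomial m (1 : K)) ∈ Submodule.span K _
      rw [this]
      exact zero_mem _
  · rw [Submodule.span_le]
    rintro _ ⟨m, rfl⟩
    exact ⟨monomial m.1 1, isHomogeneous_monomial _ m.2.2, rfl⟩

lemma IsMonomialIdeal.hilbertSeries_eq [Finite σ] {I : Ideal (MvPolynomial σ K)}
    (hI : IsMonomialIdeal I) :
    hilbertSeries I = PowerSeries.mk fun i => (standardCount (standardExponents I) i : ℤ) := by
  simp only [hilbertSeries, hI.finrank_gradedPart]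

lemma single_mem_standardExponents {I : Ideal (MvPolynomial σ K)}
    (h : ∀ f ∈ I, f.IsHomogeneous 1 → f = 0) (x : σ) :
    Finsupp.single x 1 ∈ standardExponents I := by
  intro hx
  have := h _ hx (isHomogeneous_X K x)
  simp at this

lemma exists_single_of_degree_eq_one {m : σ →₀ ℕ} (h : m.degree = 1) :
    ∃ x, m = Finsupp.single x 1 := by
  obtain ⟨x, hx⟩ : m.support.Nonempty := by
    rw [Finsupp.support_nonempty_iff]
    rintro rfl
    simp at h
  have hle : Finsupp.single x 1 ≤ m :=
    Finsupp.single_le_iff.2 (Nat.one_le_iff_ne_zero.2 (Finsupp.mem_support_iff.1 hx))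
  obtain ⟨m', rfl⟩ := exists_add_of_le hle
  refine ⟨x, ?_⟩
  rw [map_add, Finsupp.degree_single] at h
  rw [(Finsupp.degree_eq_zero_iff m').1 (by omega), add_zero]

lemma IsMonomialIdeal.eq_zero_of_isHomogeneous_one {I : Ideal (MvPolynomial σ K)}
    (hI : IsMonomialIdeal I) (h : ∀ x, Finsupp.single x 1 ∈ standardExponents I)
    {f : MvPolynomial σ K} (hf : f ∈ I) (h1 : f.IsHomogeneous 1) : f = 0 := by
  ext m
  rw [coeff_zero]
  by_contra hm
  have : m.degree = 1 := by
    rw [Finsupp.degree_eq_weight_one]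
    exact h1 hm
  obtain ⟨x, rfl⟩ := exists_single_of_degree_eq_one this
  exact hm (hI.coeff_eq_zero hf (h x))

/-- If every prime over `I` contains all but at most `d` of the variables, then `S/I` has Krull
dimension at most `d`. -/
lemma ringKrullDim_quotient_le_of_forall_prime [Finite σ] (I : Ideal (MvPolynomial σ K)) (d : ℕ)
    (h : ∀ p : Ideal (MvPolynomial σ K), p.IsPrime → I ≤ p → {x | X x ∉ p}.ncard ≤ d) :
    ringKrullDim (MvPolynomial σ K ⧸ I) ≤ d := by
  rw [ringKrullDim_quotient]
  refine iSup_le fun l => ?_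
  set p := l.head.1.asIdeal with hp
  have hIp : I ≤ p := (PrimeSpectrum.mem_zeroLocus _ _).1 l.head.2
  -- A chain of primes over `I` with least member `p` is a chain over `p`, and `S/p` is a quotient
  -- of the polynomial ring in the variables outside `p`.
  let l' : LTSeries (PrimeSpectrum.zeroLocus (p : Set (MvPolynomial σ K))) :=
    { length := l.length
      toFun := fun i => ⟨(l i).1, l.head_le i⟩
      step := fun i => l.step i }
  have h1 : (l.length : WithBot ℕ∞) ≤ ringKrullDim (MvPolynomial σ K ⧸ p) := by
    rw [ringKrullDim_quotient]
    exact Order.LTSeries.length_le_krullDim l'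
  let T := {x : σ | X x ∉ p}
  let g : MvPolynomial T K →ₐ[K] MvPolynomial σ K ⧸ p :=
    aeval fun t => Ideal.Quotient.mk p (X t.1)
  have hg : Function.Surjective g := by
    intro y
    obtain ⟨s, rfl⟩ := Ideal.Quotient.mk_surjective y
    induction s using MvPolynomial.induction_on with
    | C a => exact ⟨C a, by simp only [g, algHom_C]; rfl⟩
    | add a b ha hb =>
      obtain ⟨a', ha'⟩ := ha
      obtain ⟨b', hb'⟩ := hb
      exact ⟨a' + b', by rw [map_add, map_add, ha', hb']⟩
    | mul_X a x ha =>
      obtain ⟨a', ha'⟩ := ha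
      by_cases hx : X x ∈ p
      · refine ⟨0, ?_⟩
        rw [map_zero, map_mul, Ideal.Quotient.eq_zero_iff_mem.2 hx, mul_zero]
      · refine ⟨a' * X ⟨x, hx⟩, ?_⟩
        rw [map_mul, map_mul, ha']
        simp [g]
  have h2 := ringKrullDim_le_of_surjective g.toRingHom hg
  rw [MvPolynomial.ringKrullDim_of_isNoetherianRing, ringKrullDim_eq_zero_of_field, zero_add] at h2
  refine (h1.trans h2).trans ?_
  exact_mod_cast h p l.head.1.isPrime hIp

/-- Killing the variables outside `T` maps `S/I` onto the polynomial ring in `T`, because every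
monomial of `I` involves a variable outside `T`. -/
lemma le_ringKrullDim_quotient [Finite σ] {I : Ideal (MvPolynomial σ K)}
    (hI : IsMonomialIdeal I) (T : Finset σ)
    (hT : ∀ m : σ →₀ ℕ, m.support ⊆ T → m ∈ standardExponents I) :
    (T.card : WithBot ℕ∞) ≤ ringKrullDim (MvPolynomial σ K ⧸ I) := by
  classical
  let g : MvPolynomial σ K →ₐ[K] MvPolynomial T K :=
    aeval fun x => if h : x ∈ T then X ⟨x, h⟩ else 0
  have hg : Function.Surjective g := by
    intro s
    refine ⟨rename Subtype.val s, ?_⟩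
    rw [aeval_rename]
    convert aeval_X_left_apply s using 2
    refine congrArg _ (funext fun t => ?_)
    exact dif_pos t.2
  have hgI : ∀ s ∈ I, g.toRingHom s = 0 := by
    intro s hs
    change g s = 0
    rw [s.as_sum, map_sum]
    refine Finset.sum_eq_zero fun m hm => ?_
    have hmT : ¬ m.support ⊆ T := fun h => hI.mem_iff.1 hs m hm (hT m h)
    obtain ⟨x, hx, hxT⟩ := Finset.not_subset.1 hmT
    rw [aeval_monomial, Finsupp.prod, Finset.prod_eq_zero hx, mul_zero]
    rw [dif_neg hxT, zero_pow (Finsupp.mem_support_iff.1 hx)]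
  have h := ringKrullDim_le_of_surjective (Ideal.Quotient.lift I g.toRingHom hgI)
    (Ideal.Quotient.lift_surjective_of_surjective I hgI hg)
  rw [MvPolynomial.ringKrullDim_of_isNoetherianRing, ringKrullDim_eq_zero_of_field, zero_add] at h
  simpa using h

end

/-! ### Depth two at a prime, with denominators cleared. -/

section

section Depth

variable {S : Type*} [CommRing S]

/-- `a`, `b` form a weakly regular sequence on the localization of `S/I` at the prime ideal `p`,
expressed in terms of elements of `S`. -/
def IsRegularPairAt (I p : Ideal S) (a b : S) : Prop :=
  (∀ s, a * s ∈ I → ∃ c ∉ p, c * s ∈ I) ∧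
    ∀ s t, b * s - a * t ∈ I → ∃ c ∉ p, ∃ t', c * s - a * t' ∈ I

/-- From `b s = a^(k+1) t`, regularity of `(a, b)` gives `s = a t'`; cancelling `a` leaves `b t' =
a^k t`, to which induction applies. The elements outside `p` are the denominators. -/
lemma IsRegularPairAt.left_pow {I p : Ideal S} [p.IsPrime] {a b : S}
    (h : IsRegularPairAt I p a b) (k : ℕ) : IsRegularPairAt I p (a ^ k) b := by
  induction k with
  | zero =>
    refine ⟨fun s hs => ⟨1, p.primeCompl.one_mem, by simpa using hs⟩,
      fun s t _ => ⟨1, p.primeCompl.one_mem, s, by simp⟩⟩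
  | succ k ih =>
    constructor
    · intro s hs
      obtain ⟨c, hc, hcs⟩ := ih.1 (a * s) (by rwa [← mul_assoc, ← pow_succ])
      obtain ⟨c', hc', hcs'⟩ := h.1 (c * s) (by rwa [mul_left_comm])
      exact ⟨c' * c, p.primeCompl.mul_mem hc' hc, by rwa [mul_assoc]⟩
    · intro s t hst
      obtain ⟨c, hc, t', ht'⟩ := h.2 s (a ^ k * t) (by rwa [← mul_assoc, ← pow_succ'])
      obtain ⟨c', hc', h1⟩ := h.1 (b * t' - a ^ k * (c * t)) (by
        have : a * (b * t' - a ^ k * (c * t)) =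
          c * (b * s - a ^ (k + 1) * t) - b * (c * s - a * t') := by ring
        rw [this]
        exact I.sub_mem (I.mul_mem_left _ hst) (I.mul_mem_left _ ht'))
      obtain ⟨d, hd, t'', h2⟩ := ih.2 (c' * t') (c' * (c * t)) (by
        have : b * (c' * t') - a ^ k * (c' * (c * t)) =
          c' * (b * t' - a ^ k * (c * t)) := by ring
        rwa [this])
      refine ⟨d * c' * c, p.primeCompl.mul_mem (p.primeCompl.mul_mem hd hc') hc, t'', ?_⟩
      have : d * c' * c * s - a ^ (k + 1) * t'' =
        d * c' * (c * s - a * t') + a * (d * (c' * t') - a ^ k * t'') := by ring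
      rw [this]
      exact I.add_mem (I.mul_mem_left _ ht') (I.mul_mem_left _ h2)

lemma IsRegularPairAt.right_pow {I p : Ideal S} [p.IsPrime] {a b : S}
    (h : IsRegularPairAt I p a b) (k : ℕ) : IsRegularPairAt I p a (b ^ k) := by
  refine ⟨h.1, ?_⟩
  induction k with
  | zero => exact fun s t hst => ⟨1, p.primeCompl.one_mem, t, by simpa using hst⟩
  | succ k ih =>
    intro s t hst
    obtain ⟨c, hc, t', h1⟩ := ih (b * s) t (by rwa [← mul_assoc, ← pow_succ])
    obtain ⟨c', hc', t'', h2⟩ := h.2 (c * s) t' (by rwa [mul_left_comm])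
    exact ⟨c' * c, p.primeCompl.mul_mem hc' hc, t'', by rwa [mul_assoc]⟩

lemma IsRegularPairAt.exists_notMem_of_mul_le {I p : Ideal S} [p.IsPrime] {a b : S}
    (h : IsRegularPairAt I p a b) (ha : a ∈ p) {s : S} (hs : ∀ t ∈ p, t * s ∈ I) :
    ∃ c ∉ p, c * s ∈ I :=
  h.1 s (hs a ha)

/-- Sections over the punctured spectrum extend when the depth is at least two. -/
lemma IsRegularPairAt.exists_extension {I p : Ideal S} [p.IsPrime] {a b : S}
    (h : IsRegularPairAt I p a b) (ha : a ∈ p) (hb : b ∈ p) (k : ℕ) (f : S → S)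
    (hf : ∀ s, ∀ t ∈ p ^ k, f (s * t) - s * f t ∈ I) :
    ∃ r, ∃ c ∉ p, ∀ z ∈ p ^ k, ∃ d ∉ p, d * (c * f z - z * r) ∈ I := by
  have hk := (h.left_pow k).right_pow k
  have hak := Ideal.pow_mem_pow ha k
  have hbk := Ideal.pow_mem_pow hb k
  have h1 : b ^ k * f (a ^ k) - a ^ k * f (b ^ k) ∈ I := by
    have h2 := I.sub_mem (hf (a ^ k) _ hbk) (hf (b ^ k) _ hak)
    rw [mul_comm (b ^ k) (a ^ k)] at h2
    convert h2 using 1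
    ring
  -- The values of `f` at `a^k` and `b^k` are compatible, so `r/c` is `f(a^k)/a^k`; regularity of
  -- `a^k` then spreads the formula to all of `p^k`.
  obtain ⟨c, hc, r, h3⟩ := hk.2 _ _ h1
  refine ⟨r, c, hc, fun z hz => hk.1 _ ?_⟩
  have h4 := I.sub_mem (hf z _ hak) (hf (a ^ k) _ hz)
  rw [mul_comm (a ^ k) z] at h4
  have : a ^ k * (c * f z - z * r) = c * (f (z * a ^ k) - z * f (a ^ k) -
    (f (z * a ^ k) - a ^ k * f z)) + z * (c * f (a ^ k) - a ^ k * r) := by ring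
  rw [this]
  exact I.add_mem (I.mul_mem_left _ h4) (I.mul_mem_left _ h3)

/-- A form of Hartshorne's connectedness theorem. -/
lemma IsRegularPairAt.exists_notMem_of_mul_le_of_pow_le {I p A B : Ideal S} [p.IsPrime] {a b : S}
    (h : IsRegularPairAt I p a b) (ha : a ∈ p) (hb : b ∈ p) {k : ℕ} (hAB : A * B ≤ I)
    (hk : p ^ k ≤ A ⊔ B) :
    (∀ s ∈ A, ∃ c ∉ p, c * s ∈ I) ∨ ∀ s ∈ B, ∃ c ∉ p, c * s ∈ I := by
  have hk' := (h.left_pow k).right_pow k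
  obtain ⟨α, hα, β, hβ, hαβ⟩ := Submodule.mem_sup.1 (hk (Ideal.pow_mem_pow ha k))
  obtain ⟨γ, hγ, δ, hδ, hγδ⟩ := Submodule.mem_sup.1 (hk (Ideal.pow_mem_pow hb k))
  -- Here `r/c` plays the role of an idempotent that is `1` on `A` and `0` on `B`. In a local ring
  -- it or its complement is a unit, which decides the alternative.
  obtain ⟨c, hc, r, h1⟩ := hk'.2 α γ (by
    have : b ^ k * α - a ^ k * γ = α * δ - γ * β := by rw [← hαβ, ← hγδ]; ring
    rw [this]
    exact I.sub_mem (hAB (Ideal.mul_mem_mul hα hδ)) (hAB (Ideal.mul_mem_mul hγ hβ)))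
  by_cases hr : r ∈ p
  · refine Or.inl fun s hs => ?_
    obtain ⟨d, hd, h2⟩ := hk'.1 ((c - r) * s) (by
      have : a ^ k * ((c - r) * s) = c * (s * β) + s * (c * α - a ^ k * r) := by
        rw [← hαβ]; ring
      rw [this]
      exact I.add_mem (I.mul_mem_left _ (hAB (Ideal.mul_mem_mul hs hβ))) (I.mul_mem_left _ h1))
    refine ⟨d * (c - r), p.primeCompl.mul_mem hd fun h => hc ?_, by rwa [mul_assoc]⟩
    simpa using p.add_mem h hr
  · refine Or.inr fun s hs => ?_
    obtain ⟨d, hd, h2⟩ := hk'.1 (r * s) (by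
      have : a ^ k * (r * s) = c * (α * s) - s * (c * α - a ^ k * r) := by ring
      rw [this]
      exact I.sub_mem (I.mul_mem_left _ (hAB (Ideal.mul_mem_mul hα hs))) (I.mul_mem_left _ h1))
    exact ⟨d * r, p.primeCompl.mul_mem hd hr, by rwa [mul_assoc]⟩

end Depth

lemma IsCohenMacaulayLocal.exists_pair {A : Type*} [CommRing A] [IsLocalRing A]
    (h : IsCohenMacaulayLocal A) (hdim : 2 ≤ ringKrullDim A) :
    ∃ a ∈ IsLocalRing.maximalIdeal A, ∃ b ∈ IsLocalRing.maximalIdeal A,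
      (∀ s, a * s = 0 → s = 0) ∧ ∀ s, a ∣ b * s → a ∣ s := by
  obtain ⟨rs, hrs, hreg, hlen⟩ := h
  rw [← hlen] at hdim
  have hlen2 : 2 ≤ rs.length := by exact_mod_cast hdim
  match rs, hlen2 with
  | a :: b :: rs, _ =>
    have h1 := hreg.toIsWeaklyRegular
    rw [RingTheory.Sequence.isWeaklyRegular_cons_iff,
      RingTheory.Sequence.isWeaklyRegular_cons_iff] at h1
    refine ⟨a, hrs a (by simp), b, hrs b (by simp), fun s hs => ?_, fun s hs => ?_⟩
    · exact h1.1 (by simpa using hs)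
    · have h2 := h1.2.1
      have hq : ∀ u : A, (Submodule.Quotient.mk u : QuotSMulTop a A) = 0 ↔ a ∣ u := by
        intro u
        rw [Submodule.Quotient.mk_eq_zero, Submodule.mem_smul_pointwise_iff_exists]
        constructor
        · rintro ⟨v, _, rfl⟩
          exact ⟨v, rfl⟩
        · rintro ⟨v, rfl⟩
          exact ⟨v, trivial, rfl⟩
      rw [← hq]
      apply h2
      change b • (Submodule.Quotient.mk s : QuotSMulTop a A) = b • 0
      rw [smul_zero, ← Submodule.Quotient.mk_smul, hq]
      exact hs

/-- Up to units, elements of the localization are images of elements of `S`, so a regular pair there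
can be replaced by one coming from `S`. -/
lemma exists_isRegularPairAt {S : Type*} [CommRing S] (I p : Ideal S) [p.IsPrime]
    (q : Ideal (S ⧸ I)) [q.IsPrime] (hq : q.comap (Ideal.Quotient.mk I) = p)
    (h : IsCohenMacaulayLocal (Localization.AtPrime q))
    (hdim : 2 ≤ ringKrullDim (Localization.AtPrime q)) :
    ∃ a ∈ p, ∃ b ∈ p, IsRegularPairAt I p a b := by
  obtain ⟨a, ha, b, hb, h1, h2⟩ := h.exists_pair hdim
  let φ : S →+* Localization.AtPrime q :=
    (algebraMap (S ⧸ I) (Localization.AtPrime q)).comp (Ideal.Quotient.mk I)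
  have hmem : ∀ s, s ∈ p ↔ Ideal.Quotient.mk I s ∈ q := fun s => by rw [← hq]; rfl
  have hφ0 : ∀ s, φ s = 0 → ∃ c ∉ p, c * s ∈ I := by
    intro s hs
    obtain ⟨m, hm⟩ := (IsLocalization.map_eq_zero_iff q.primeCompl _ _).1 hs
    obtain ⟨c, hc⟩ := Ideal.Quotient.mk_surjective m.1
    refine ⟨c, fun h => m.2 ?_, ?_⟩
    · rw [← hc]; exact (hmem c).1 h
    · rw [← Ideal.Quotient.eq_zero_iff_mem, map_mul, hc, hm]
  have hφI : ∀ s ∈ I, φ s = 0 := by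
    intro s hs
    simp only [φ, RingHom.comp_apply, Ideal.Quotient.eq_zero_iff_mem.2 hs, map_zero]
  have hunit : ∀ c ∉ p, IsUnit (φ c) := fun c hc =>
    IsLocalization.map_units (Localization.AtPrime q)
      (⟨Ideal.Quotient.mk I c, fun h => hc ((hmem c).2 h)⟩ : q.primeCompl)
  have hsurj : ∀ x : Localization.AtPrime q, ∃ c ∉ p, ∃ s, φ c * x = φ s := by
    intro x
    obtain ⟨⟨y, m⟩, hy⟩ := IsLocalization.surj q.primeCompl x
    obtain ⟨s, rfl⟩ := Ideal.Quotient.mk_surjective y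
    obtain ⟨c, hc⟩ := Ideal.Quotient.mk_surjective m.1
    refine ⟨c, fun h => m.2 ?_, s, ?_⟩
    · rw [← hc]; exact (hmem c).1 h
    · rw [mul_comm, RingHom.comp_apply, hc, hy]; rfl
  have hmax : ∀ s, φ s ∈ IsLocalRing.maximalIdeal (Localization.AtPrime q) → s ∈ p := by
    intro s hs
    by_contra h
    exact (IsLocalRing.mem_maximalIdeal _).1 hs (hunit s h)
  obtain ⟨ca, hca, a', ha'⟩ := hsurj a
  obtain ⟨cb, hcb, b', hb'⟩ := hsurj b
  refine ⟨a', hmax _ (ha' ▸ Ideal.mul_mem_left _ _ ha), b',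
    hmax _ (hb' ▸ Ideal.mul_mem_left _ _ hb), fun s hs => hφ0 s ?_, fun s t hst => ?_⟩
  · have := hφI _ hs
    rw [map_mul, ← ha', mul_assoc, (hunit ca hca).mul_right_eq_zero] at this
    exact h1 _ this
  · have := hφI _ hst
    rw [map_sub, map_mul, map_mul, ← ha', ← hb', sub_eq_zero] at this
    obtain ⟨y, hy⟩ := h2 (φ s) (by
      rw [← (hunit cb hcb).dvd_mul_left, ← mul_assoc, this, mul_assoc]
      exact ⟨φ ca * φ t, by ring⟩)
    obtain ⟨cy, hcy, t', ht'⟩ := hsurj y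
    obtain ⟨c, hc, h3⟩ := hφ0 (ca * cy * s - a' * t') (by
      rw [map_sub, map_mul, map_mul, map_mul, ← ha', ← ht', hy]
      ring)
    refine ⟨c * (ca * cy), p.primeCompl.mul_mem hc (p.primeCompl.mul_mem hca hcy), c * t', ?_⟩
    convert h3 using 1
    ring

end

/-! ### Coordinate cones, and the absence of associated primes of small dimension. -/

section

/-- The monomials `x^(u+m)`, with `m` supported in `T`, all belong to `L`. -/
def IsCone {σ : Type*} (L : Set (σ →₀ ℕ)) (u : σ →₀ ℕ) (T : Set σ) : Prop :=
  ∀ m : σ →₀ ℕ, (m.support : Set σ) ⊆ T → u + m ∈ L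

lemma IsCone.mono {σ : Type*} {L : Set (σ →₀ ℕ)} (hL : IsLowerSet L) {u v : σ →₀ ℕ} {T : Set σ}
    (h : IsCone L u T) (hv : v ≤ u) : IsCone L v T :=
  fun m hm => hL (add_le_add_left hv m) (h m hm)

variable {σ K : Type*} [Field K]

open Classical in
variable (K) in
/-- Set the variables outside `T` to zero. -/
def restrictVars (T : Set σ) : MvPolynomial σ K →ₐ[K] MvPolynomial σ K :=
  aeval fun x => if x ∈ T then X x else 0

open Classical in
lemma restrictVars_X (T : Set σ) (x : σ) :
    restrictVars K T (X x) = if x ∈ T then X x else 0 := by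
  rw [restrictVars, aeval_X]

open Classical in
lemma restrictVars_monomial (T : Set σ) (m : σ →₀ ℕ) (c : K) :
    restrictVars K T (monomial m c) = if (m.support : Set σ) ⊆ T then monomial m c else 0 := by
  rw [restrictVars, aeval_monomial]
  split_ifs with h
  · rw [monomial_eq, algebraMap_eq]
    congr 1
    exact Finsupp.prod_congr fun x hx => by rw [if_pos (h hx)]
  · obtain ⟨x, hx, hxT⟩ := Set.not_subset.1 h
    rw [Finsupp.prod, Finset.prod_eq_zero hx, mul_zero]
    rw [if_neg hxT, zero_pow (Finsupp.mem_support_iff.1 hx)]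

open Classical in
lemma coeff_restrictVars (T : Set σ) (m : σ →₀ ℕ) (s : MvPolynomial σ K) :
    coeff m (restrictVars K T s) = if (m.support : Set σ) ⊆ T then coeff m s else 0 := by
  induction s using MvPolynomial.induction_on' with
  | monomial u a =>
    rw [restrictVars_monomial]
    by_cases h : u = m
    · subst h
      split_ifs <;> simp
    · split_ifs <;> simp [coeff_monomial, h]
  | add p q hp hq =>
    rw [map_add, coeff_add, hp, hq, coeff_add]
    split_ifs <;> simp

/-- This kernel is the ideal generated by the variables outside `T`; presented as a kernel it is
visibly prime. -/
lemma mem_ker_restrictVars {T : Set σ} {s : MvPolynomial σ K} :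
    s ∈ RingHom.ker (restrictVars K T) ↔
      ∀ m : σ →₀ ℕ, (m.support : Set σ) ⊆ T → coeff m s = 0 := by
  classical
  rw [RingHom.mem_ker, MvPolynomial.ext_iff]
  refine forall_congr' fun m => ?_
  rw [coeff_restrictVars, coeff_zero]
  split_ifs with h <;> simp [h]

lemma X_mem_ker_restrictVars {T : Set σ} {x : σ} :
    X x ∈ RingHom.ker (restrictVars K T) ↔ x ∉ T := by
  classical
  rw [RingHom.mem_ker, restrictVars_X]
  split_ifs with h <;> simp [h]

lemma ker_restrictVars_anti {T T' : Set σ} (h : T ⊆ T') :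
    RingHom.ker (restrictVars K T') ≤ RingHom.ker (restrictVars K T) := by
  intro s hs
  rw [mem_ker_restrictVars] at hs ⊢
  exact fun m hm => hs m (hm.trans h)

lemma mem_idealOfVars_iff {s : MvPolynomial σ K} : s ∈ idealOfVars σ K ↔ coeff 0 s = 0 := by
  have := mem_pow_idealOfVars_iff' 1 s
  rw [pow_one] at this
  simp [this, Finsupp.degree_eq_zero_iff]

lemma idealOfVars_eq_ker : idealOfVars σ K = RingHom.ker (restrictVars K (∅ : Set σ)) := by
  ext s
  rw [mem_idealOfVars_iff, mem_ker_restrictVars]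
  simp

instance isPrime_idealOfVars : (idealOfVars σ K).IsPrime := by
  rw [idealOfVars_eq_ker]
  exact RingHom.ker_isPrime _

lemma exists_mem_support_of_monomial_mem {p : Ideal (MvPolynomial σ K)} [hp : p.IsPrime]
    {m : σ →₀ ℕ} (h : monomial m (1 : K) ∈ p) : ∃ x ∈ m.support, X x ∈ p := by
  rw [monomial_eq, C_1, one_mul, Finsupp.prod, hp.prod_mem_iff] at h
  obtain ⟨x, hx, h⟩ := h
  exact ⟨x, hx, hp.mem_of_pow_mem _ h⟩

/-- Otherwise every pair of variables supports a monomial of `I`, so a prime over `I` misses at most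
one variable and the dimension is at most one. -/
lemma exists_isCone_pair [Finite σ] {I : Ideal (MvPolynomial σ K)}
    (hdim : 2 ≤ ringKrullDim (MvPolynomial σ K ⧸ I)) :
    ∃ x y, x ≠ y ∧ IsCone (standardExponents I) 0 {x, y} := by
  by_contra! hcon
  have := ringKrullDim_quotient_le_of_forall_prime I 1 fun p hp hIp => by
    rw [Set.ncard_le_one]
    intro x hx y hy
    by_contra hxy
    have := hcon x y hxy
    simp only [IsCone, not_forall, zero_add] at this
    obtain ⟨m, hm, hmI⟩ := this
    obtain ⟨z, hz, hzp⟩ := exists_mem_support_of_monomial_mem (hIp (not_not.1 hmI))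
    rcases hm hz with rfl | rfl
    · exact hx hzp
    · exact hy hzp
  have h := hdim.trans this
  exact absurd h (by norm_num)

lemma IsMonomialIdeal.le_ker_restrictVars {I : Ideal (MvPolynomial σ K)} (hI : IsMonomialIdeal I)
    {T : Set σ} (hT : IsCone (standardExponents I) 0 T) : I ≤ RingHom.ker (restrictVars K T) := by
  intro s hs
  rw [mem_ker_restrictVars]
  intro m hm
  exact hI.coeff_eq_zero hs (by simpa using hT m hm)

/-- Killing all variables but `x, y`, then also `y`, then also `x`, gives a strict chain of three
primes over `I` ending at the origin. -/
lemma IsMonomialIdeal.two_le_ringKrullDim_localization {I : Ideal (MvPolynomial σ K)}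
    (hI : IsMonomialIdeal I) {x y : σ} (hxy : x ≠ y)
    (hcone : IsCone (standardExponents I) 0 {x, y}) (q : Ideal (MvPolynomial σ K ⧸ I)) [q.IsPrime]
    (hq : q.comap (Ideal.Quotient.mk I) = idealOfVars σ K) :
    2 ≤ ringKrullDim (Localization.AtPrime q) := by
  rw [IsLocalization.AtPrime.ringKrullDim_eq_height q (Localization.AtPrime q)]
  have hI2 := hI.le_ker_restrictVars hcone
  have hle1 : RingHom.ker (restrictVars K {x, y}) ≤ RingHom.ker (restrictVars K {x}) :=
    ker_restrictVars_anti (by simp)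
  have hle0 : RingHom.ker (restrictVars K {x}) ≤ RingHom.ker (restrictVars K (∅ : Set σ)) :=
    ker_restrictVars_anti (by simp)
  have key : ∀ J : Ideal (MvPolynomial σ K), I ≤ J → J.IsPrime →
      (J.map (Ideal.Quotient.mk I)).IsPrime ∧
        (J.map (Ideal.Quotient.mk I)).comap (Ideal.Quotient.mk I) = J := by
    intro J hIJ hJ
    refine ⟨Ideal.map_isPrime_of_surjective Ideal.Quotient.mk_surjective (by simpa using hIJ), ?_⟩
    rw [Ideal.comap_map_of_surjective _ Ideal.Quotient.mk_surjective, ← RingHom.ker_eq_comap_bot,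
      Ideal.mk_ker, sup_eq_left.2 hIJ]
  obtain ⟨hp2, hc2⟩ := key _ hI2 (RingHom.ker_isPrime _)
  obtain ⟨hp1, hc1⟩ := key _ (hI2.trans hle1) (RingHom.ker_isPrime _)
  have hlt1 : (RingHom.ker (restrictVars K {x, y})).map (Ideal.Quotient.mk I) <
      (RingHom.ker (restrictVars K {x})).map (Ideal.Quotient.mk I) := by
    refine lt_of_le_not_ge (Ideal.map_mono hle1) fun h => ?_
    have h' := Ideal.comap_mono (f := Ideal.Quotient.mk I) h
    rw [hc1, hc2] at h'
    have hy : X y ∈ RingHom.ker (restrictVars K {x}) :=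
      X_mem_ker_restrictVars.2 (by simpa using hxy.symm)
    exact X_mem_ker_restrictVars.1 (h' hy) (by simp)
  have hlt0 : (RingHom.ker (restrictVars K {x})).map (Ideal.Quotient.mk I) < q := by
    have hle : (RingHom.ker (restrictVars K {x})).map (Ideal.Quotient.mk I) ≤ q := by
      rw [Ideal.map_le_iff_le_comap, hq, idealOfVars_eq_ker]
      exact hle0
    refine lt_of_le_not_ge hle fun h => ?_
    have h' := Ideal.comap_mono (f := Ideal.Quotient.mk I) h
    rw [hc1, hq, idealOfVars_eq_ker] at h'
    have hx : X x ∈ RingHom.ker (restrictVars K (∅ : Set σ)) :=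
      X_mem_ker_restrictVars.2 (by simp)
    exact X_mem_ker_restrictVars.1 (h' hx) (by simp)
  have h1 := Ideal.height_add_one_le_of_lt_of_isPrime hlt1
  have h0 := Ideal.height_add_one_le_of_lt_of_isPrime hlt0
  have : (2 : ℕ∞) ≤ q.height := by
    calc (2 : ℕ∞) = 0 + 1 + 1 := by norm_num
      _ ≤ _ := add_le_add_left (add_le_add_left (zero_le) _) _
      _ ≤ _ := add_le_add_left h1 _
      _ ≤ _ := h0
  exact WithBot.coe_le_coe.2 this

lemma IsMonomialIdeal.exists_isRegularPairAt [Finite σ] {I : Ideal (MvPolynomial σ K)}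
    (hI : IsMonomialIdeal I) (hdim : ringKrullDim (MvPolynomial σ K ⧸ I) = 2)
    (hCM : IsCohenMacaulay (MvPolynomial σ K ⧸ I)) :
    ∃ a ∈ idealOfVars σ K, ∃ b ∈ idealOfVars σ K, IsRegularPairAt I (idealOfVars σ K) a b := by
  obtain ⟨x, y, hxy, hcone⟩ := exists_isCone_pair hdim.ge
  have hle : I ≤ idealOfVars σ K := by
    rw [idealOfVars_eq_ker]
    exact (hI.le_ker_restrictVars hcone).trans (ker_restrictVars_anti (by simp))
  have hmax : (idealOfVars σ K).IsMaximal := by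
    have : idealOfVars σ K = RingHom.ker (constantCoeff : MvPolynomial σ K →+* K) := by
      ext s
      rw [mem_idealOfVars_iff, RingHom.mem_ker, constantCoeff_eq]
    rw [this]
    exact RingHom.ker_isMaximal_of_surjective _ fun c => ⟨C c, constantCoeff_C _ c⟩
  have hcomap : ((idealOfVars σ K).map (Ideal.Quotient.mk I)).comap (Ideal.Quotient.mk I) =
      idealOfVars σ K := by
    rw [Ideal.comap_map_of_surjective _ Ideal.Quotient.mk_surjective, ← RingHom.ker_eq_comap_bot,
      Ideal.mk_ker, sup_eq_left.2 hle]
  have hq : ((idealOfVars σ K).map (Ideal.Quotient.mk I)).IsMaximal := by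
    refine (Ideal.map_eq_top_or_isMaximal_of_surjective _ Ideal.Quotient.mk_surjective
      hmax).resolve_left fun h => ?_
    rw [h, Ideal.comap_top] at hcomap
    exact hmax.ne_top hcomap.symm
  exact MonomialTrees.exists_isRegularPairAt I (idealOfVars σ K) _ hcomap (hCM.2 _)
    (hI.two_le_ringKrullDim_localization hxy hcone _ hcomap)

lemma IsMonomialIdeal.monomial_mul_mem_iff {I : Ideal (MvPolynomial σ K)}
    (hI : IsMonomialIdeal I) {w : σ →₀ ℕ} {s : MvPolynomial σ K} :
    monomial w 1 * s ∈ I ↔ ∀ m ∈ s.support, w + m ∉ standardExponents I := by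
  constructor
  · intro h m hm hw
    have := hI.coeff_eq_zero h hw
    rw [coeff_monomial_mul, one_mul] at this
    exact mem_support_iff.1 hm this
  · intro h
    rw [s.as_sum, Finset.mul_sum]
    refine I.sum_mem fun m hm => ?_
    rw [monomial_mul]
    exact monomial_mem_of_le le_rfl (not_not.1 (h m hm)) _

/-- Every standard monomial divides one whose annihilator is generated by variables. -/
lemma exists_isCone_of_mem [Finite σ] {I : Ideal (MvPolynomial σ K)} {u : σ →₀ ℕ}
    (hu : u ∈ standardExponents I) :
    ∃ w ≥ u, w ∈ standardExponents I ∧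
      IsCone (standardExponents I) w {x | w + Finsupp.single x 1 ∈ standardExponents I} := by
  let colon : (σ →₀ ℕ) → Ideal (MvPolynomial σ K) := fun w =>
    Submodule.comap (LinearMap.mulLeft (MvPolynomial σ K) (monomial w (1 : K))) I
  have hcolon : ∀ w v, monomial v 1 ∈ colon w ↔ w + v ∉ standardExponents I := by
    intro w v
    change monomial w 1 * monomial v 1 ∈ I ↔ _
    rw [monomial_mul, one_mul]
    exact not_not.symm
  obtain ⟨_, ⟨w, ⟨huw, hw⟩, rfl⟩, hmax⟩ := set_has_maximal_iff_noetherian.2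
    (inferInstance : IsNoetherian (MvPolynomial σ K) (MvPolynomial σ K))
    (colon '' {w | u ≤ w ∧ w ∈ standardExponents I}) ⟨_, u, ⟨le_rfl, hu⟩, rfl⟩
  -- The ideal `I : x^w` is maximal among the colon ideals of standard multiples of `x^u`.
  -- Multiplying by `x^v` cannot enlarge it, so the `v` with `w + v` standard are closed under
  -- addition.
  have hstep : ∀ v v', w + v ∈ standardExponents I → w + v' ∈ standardExponents I →
      w + (v + v') ∈ standardExponents I := by
    intro v v' hv hv'
    have h1 := hmax (colon (w + v)) ⟨_, ⟨huw.trans le_self_add, hv⟩, rfl⟩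
    have hle : colon w ≤ colon (w + v) := by
      intro s hs
      change monomial (w + v) 1 * s ∈ I
      rw [add_comm w v, ← one_mul (1 : K), ← monomial_mul, mul_assoc]
      exact I.mul_mem_left _ hs
    by_contra hcon
    rw [← add_assoc, ← hcolon] at hcon
    have h2 : colon (w + v) ≤ colon w := by
      by_contra h
      exact h1 (lt_of_le_not_ge hle h)
    exact (hcolon w v').1 (h2 hcon) hv'
  refine ⟨w, huw, hw, fun m => ?_⟩
  induction m using Finsupp.induction_linear with
  | zero => exact fun _ => by simpa using hw
  | add f g hf hg =>
    intro hfg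
    refine hstep _ _ (hf fun x hx => hfg ?_) (hg fun x hx => hfg ?_) <;>
    · simp only [Finset.mem_coe, Finsupp.mem_support_iff, Finsupp.add_apply] at hx ⊢
      omega
  | single x n =>
    intro hx
    induction n with
    | zero => simpa using hw
    | succ n ih =>
      have hxT : x ∈ {x | w + Finsupp.single x 1 ∈ standardExponents I} := hx (by simp)
      rw [Finsupp.single_add]
      refine hstep _ _ (ih fun y hy => ?_) hxT
      have := Finsupp.support_single_subset hy
      rw [Finset.mem_singleton] at this
      exact this ▸ hxT

/-- The ring `S/I` has no associated prime of dimension at most one, in combinatorial form. -/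
theorem IsMonomialIdeal.exists_isCone [Finite σ] {I : Ideal (MvPolynomial σ K)}
    (hI : IsMonomialIdeal I) {a b : MvPolynomial σ K} (ha : a ∈ idealOfVars σ K)
    (hb : b ∈ idealOfVars σ K) (hab : IsRegularPairAt I (idealOfVars σ K) a b) {u : σ →₀ ℕ}
    (hu : u ∈ standardExponents I) :
    ∃ x y, x ≠ y ∧ IsCone (standardExponents I) u {x, y} := by
  classical
  obtain ⟨w, huw, hw, hcone⟩ := exists_isCone_of_mem hu
  set T := {x | w + Finsupp.single x 1 ∈ standardExponents I} with hT
  have hout : ∀ m : σ →₀ ℕ, ¬ (m.support : Set σ) ⊆ T → w + m ∉ standardExponents I := by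
    intro m hm hwm
    obtain ⟨x, hx, hxT⟩ := Set.not_subset.1 hm
    refine hxT (isLowerSet_standardExponents I (add_le_add_right ?_ w) hwm)
    exact Finsupp.single_le_iff.2 (Nat.one_le_iff_ne_zero.2 (Finsupp.mem_support_iff.1 hx))
  by_cases hsub : T.Subsingleton
  swap
  · obtain ⟨x, hx, y, hy, hxy⟩ := Set.not_subsingleton_iff.1 hsub
    refine ⟨x, y, hxy, IsCone.mono (isLowerSet_standardExponents I) (fun m hm => hcone m ?_) huw⟩
    exact hm.trans (Set.insert_subset hx (Set.singleton_subset_iff.2 hy))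
  exfalso
  have hker : ∀ s ∈ RingHom.ker (restrictVars K T), monomial w 1 * s ∈ I := by
    intro s hs
    rw [hI.monomial_mul_mem_iff]
    intro m hm
    refine hout m fun h => ?_
    exact mem_support_iff.1 hm (mem_ker_restrictVars.1 hs m h)
  rcases hsub.eq_empty_or_singleton with hT0 | ⟨x, hTx⟩
  -- If `T` is empty, `x^w` is a socle element, which contradicts positive depth.
  · obtain ⟨c, hc, hcw⟩ := hab.exists_notMem_of_mul_le ha (s := monomial w 1) fun t ht => by
      rw [mul_comm]
      refine hker t ?_
      rwa [hT0, ← idealOfVars_eq_ker]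
    have := hI.coeff_eq_zero hcw hw
    rw [coeff_mul_monomial', if_pos le_rfl, tsub_self, mul_one] at this
    exact hc (mem_idealOfVars_iff.2 this)
  · let π : MvPolynomial σ K →ₐ[K] Polynomial K := aeval fun y => if y = x then Polynomial.X else 0
    let ι : Polynomial K →ₐ[K] MvPolynomial σ K := Polynomial.aeval (X x)
    have hιπ : ∀ s, ι (π s) = restrictVars K T s := by
      intro s
      change (ι.comp π) s = _
      congr 1
      refine MvPolynomial.algHom_ext fun y => ?_
      rw [restrictVars_X, hTx, AlgHom.comp_apply, aeval_X]
      by_cases h : y = x <;> simp [h, ι]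
    -- With this exponent `x^k` does not divide `x^w`, so multiples of `x^k` have no term `x^w`.
    set k := w x + 1 with hk
    have hdvd : ∀ t ∈ idealOfVars σ K ^ k, Polynomial.X ^ k ∣ π t := by
      intro t ht
      rw [← Ideal.mem_span_singleton, ← Ideal.span_singleton_pow]
      have h1 := Ideal.mem_map_of_mem π ht
      rw [Ideal.map_pow] at h1
      refine Ideal.pow_right_mono ?_ k h1
      rw [Ideal.map_le_iff_le_comap, idealOfVars, Ideal.span_le]
      rintro _ ⟨y, rfl⟩
      simp only [SetLike.mem_coe, Ideal.mem_comap, Ideal.mem_span_singleton, π, aeval_X]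
      split_ifs <;> simp
    have hmonic : (Polynomial.X ^ k : Polynomial K).Monic := Polynomial.monic_X_pow k
    -- If `T = {x}`, then `S x^w` is a copy of `K[x]` in `S/I`. The map "restrict to `K[x]`, divide
    -- by `x^k`, multiply by `x^w`" is linear on the `k`-th power of the ideal of the variables.
    -- Depth two makes it multiplication by `r/c`; evaluation at `x^k` gives `c x^w = x^k r`
    -- locally, which is impossible.
    obtain ⟨r, c, hc, hr⟩ := hab.exists_extension ha hb k
      (fun s => monomial w 1 * ι (Polynomial.divByMonic (π s) (Polynomial.X ^ k))) (by
        intro s t ht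
        obtain ⟨τ, hτ⟩ := hdvd t ht
        have h1 : π (s * t) = Polynomial.X ^ k * (π s * τ) := by
          rw [map_mul, hτ, mul_left_comm]
        rw [h1, hτ, Polynomial.mul_divByMonic_cancel_left _ hmonic,
          Polynomial.mul_divByMonic_cancel_left _ hmonic, map_mul, hιπ]
        have h2 : monomial w 1 * (restrictVars K T s * ι τ) - s * (monomial w 1 * ι τ) =
          ι τ * (monomial w 1 * (restrictVars K T s - s)) := by ring
        rw [h2]
        refine I.mul_mem_left _ (hker _ ?_)
        rw [mem_ker_restrictVars]
        intro m hm
        rw [coeff_sub, coeff_restrictVars, if_pos hm, sub_self])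
    obtain ⟨d, hd, h1⟩ := hr (X x ^ k)
      (Ideal.pow_mem_pow (Ideal.subset_span (Set.mem_range_self x)) k)
    have h2 : π (X x ^ k) = Polynomial.X ^ k * 1 := by simp [π]
    rw [h2, Polynomial.mul_divByMonic_cancel_left _ hmonic, map_one ι, mul_one] at h1
    have h3 := hI.coeff_eq_zero h1 hw
    have h4 : d * (c * monomial w 1 - X x ^ k * r) =
      d * c * monomial w 1 - monomial (Finsupp.single x k) 1 * (d * r) := by
      rw [← X_pow_eq_monomial]; ring
    rw [h4, coeff_sub, coeff_mul_monomial', if_pos le_rfl, tsub_self, mul_one,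
      coeff_monomial_mul', if_neg, sub_zero] at h3
    · have := isPrime_idealOfVars.mem_or_mem (mem_idealOfVars_iff.2 h3)
      exact this.elim hd hc
    · rw [Finsupp.single_le_iff]
      omega

end

/-! ### Connectedness of the face graph, and counting cones against the multiplicity. -/

section

lemma exists_forall_of_monotone {ι : Type*} [Finite ι] {P : ι → ℕ → Prop}
    (hmono : ∀ i m n, m ≤ n → P i m → P i n) (h : ∀ i, ∃ n, P i n) : ∃ N, ∀ i, P i N := by
  have : ∀ᶠ N in Filter.atTop, ∀ i, P i N := by
    rw [Filter.eventually_all]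
    intro i
    obtain ⟨n, hn⟩ := h i
    filter_upwards [Filter.eventually_ge_atTop n] with N hN using hmono i n N hN hn
  exact this.exists

section Faces

variable {σ : Type*}

/-- The vertices lying on a two-dimensional coordinate cone contained in `L`. -/
def faceVertices (L : Set (σ →₀ ℕ)) : Set σ := {x | ∃ y, x ≠ y ∧ IsCone L 0 {x, y}}

/-- The graph of the two-dimensional coordinate cones contained in `L`. -/
def faceGraph (L : Set (σ →₀ ℕ)) : SimpleGraph (faceVertices L) where
  Adj x y := (x : σ) ≠ y ∧ IsCone L 0 {(x : σ), (y : σ)}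
  symm := ⟨fun x y h => ⟨h.1.symm, by rw [Set.pair_comm]; exact h.2⟩⟩
  loopless := ⟨fun _ h => h.1 rfl⟩

variable {L : Set (σ →₀ ℕ)}

/-- If all powers of `y` were standard, a single pair `{x, z}` would, by finiteness, serve as cone
directions at all of them, and `{y, x, z}` would span a three-dimensional cone. -/
lemma exists_single_notMem [Finite σ] (hL : IsLowerSet L)
    (hcov : ∀ u ∈ L, ∃ x y, x ≠ y ∧ IsCone L u {x, y})
    (h3 : ∀ T : Finset σ, IsCone L 0 T → T.card ≤ 2) {y : σ} (hy : y ∉ faceVertices L) :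
    ∃ n, Finsupp.single y n ∉ L := by
  classical
  by_contra! hcon
  have hex : ∃ x z, x ≠ z ∧ ∀ n, IsCone L (Finsupp.single y n) {x, z} := by
    by_contra! hne
    obtain ⟨N, hN⟩ := exists_forall_of_monotone
      (P := fun (p : σ × σ) n => p.1 ≠ p.2 → ¬ IsCone L (Finsupp.single y n) {p.1, p.2})
      (fun p m n hmn h hp hc => h hp (hc.mono hL (Finsupp.single_le_single.2 hmn))) (fun p => by
        by_cases hp : p.1 = p.2
        · exact ⟨0, fun h => (h hp).elim⟩
        · obtain ⟨n, hn⟩ := hne p.1 p.2 hp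
          exact ⟨n, fun _ => hn⟩)
    obtain ⟨x, z, hxz, hc⟩ := hcov _ (hcon N)
    exact hN (x, z) hxz hc
  obtain ⟨x, z, hxz, hc⟩ := hex
  have hc0 : IsCone L 0 {x, z} := (hc 0).mono hL (by simp)
  have hyx : y ≠ x := fun h => hy ⟨z, h ▸ hxz, h ▸ hc0⟩
  have hyz : y ≠ z := fun h => hy ⟨x, h ▸ hxz.symm, by rw [h, Set.pair_comm]; exact hc0⟩
  have h := h3 {y, x, z} (by
    intro m hm
    have h1 := hc (m y) (m.erase y) (by
      intro w hw
      rw [Finsupp.support_erase, Finset.mem_coe, Finset.mem_erase] at hw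
      have := hm hw.2
      simp only [Finset.coe_insert, Finset.coe_singleton, Set.mem_insert_iff, hw.1,
        false_or] at this
      simpa using this)
    rwa [Finsupp.single_add_erase, ← zero_add m] at h1)
  rw [Finset.card_eq_three.2 ⟨y, x, z, hyx, hyz, hxz, rfl⟩] at h
  omega

lemma exists_single_add_single_notMem (hL : IsLowerSet L) {x y : σ} (hxy : x ≠ y)
    (h : ¬ IsCone L 0 {x, y}) : ∃ n, Finsupp.single x n + Finsupp.single y n ∉ L := by
  classical
  simp only [IsCone, not_forall, zero_add] at h
  obtain ⟨m, hm, hmL⟩ := h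
  refine ⟨max (m x) (m y), fun hn => hmL (hL (fun z => ?_) hn)⟩
  by_cases hz : m z = 0
  · rw [hz]; exact Nat.zero_le _
  · rcases hm (Finsupp.mem_support_iff.2 hz) with rfl | rfl
    · simp [hxy.symm]
    · simp [hxy]

end Faces

variable {σ K : Type*} [Field K]

lemma IsMonomialIdeal.mul_monomial_notMem {I : Ideal (MvPolynomial σ K)}
    (hI : IsMonomialIdeal I) {m : σ →₀ ℕ} (hm : m ∈ standardExponents I) {c : MvPolynomial σ K}
    (hc : c ∉ idealOfVars σ K) : c * monomial m 1 ∉ I := by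
  intro h
  have := hI.coeff_eq_zero h hm
  rw [coeff_mul_monomial', if_pos le_rfl, tsub_self, mul_one] at this
  exact hc (mem_idealOfVars_iff.2 this)

/-- High powers of the vertices inside and outside one component generate ideals whose product lies
in `I`, since non-faces have high powers in `I`. With `I` they generate an ideal whose radical
contains all variables, since variables off the graph are nilpotent. Hartshorne's lemma would then
make a power of some vertex vanish locally. -/
theorem IsMonomialIdeal.preconnected_faceGraph [Finite σ] {I : Ideal (MvPolynomial σ K)}
    (hI : IsMonomialIdeal I) {a b : MvPolynomial σ K} (ha : a ∈ idealOfVars σ K)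
    (hb : b ∈ idealOfVars σ K) (hab : IsRegularPairAt I (idealOfVars σ K) a b)
    (h3 : ∀ T : Finset σ, IsCone (standardExponents I) 0 T → T.card ≤ 2) :
    (faceGraph (standardExponents I)).Preconnected := by
  set L := standardExponents I
  intro v₀ y₀
  by_contra hne
  have hL : IsLowerSet L := isLowerSet_standardExponents I
  obtain ⟨N₁, hN₁⟩ := exists_forall_of_monotone
    (P := fun (y : σ) n => y ∉ faceVertices L → Finsupp.single y n ∉ L)
    (fun y m n hmn h hy hn => h hy (hL (Finsupp.single_le_single.2 hmn) hn)) (fun y => by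
      by_cases hy : y ∈ faceVertices L
      · exact ⟨0, fun h => (h hy).elim⟩
      · obtain ⟨n, hn⟩ := exists_single_notMem hL
          (fun u hu => hI.exists_isCone ha hb hab hu) h3 hy
        exact ⟨n, fun _ => hn⟩)
  obtain ⟨N₂, hN₂⟩ := exists_forall_of_monotone
    (P := fun (p : σ × σ) n => p.1 ≠ p.2 → ¬ IsCone L 0 {p.1, p.2} →
      Finsupp.single p.1 n + Finsupp.single p.2 n ∉ L)
    (fun p m n hmn h hp hc hn => h hp hc (hL (add_le_add (Finsupp.single_le_single.2 hmn)
      (Finsupp.single_le_single.2 hmn)) hn)) (fun p => by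
      by_cases hp : p.1 ≠ p.2 ∧ ¬ IsCone L 0 {p.1, p.2}
      · obtain ⟨n, hn⟩ := exists_single_add_single_notMem hL hp.1 hp.2
        exact ⟨n, fun _ _ => hn⟩
      · exact ⟨0, fun h h' => (hp ⟨h, h'⟩).elim⟩)
  set V₁ : Set (faceVertices L) := {v | (faceGraph L).Reachable v₀ v} with hV₁
  let pow (n : ℕ) (v : faceVertices L) : MvPolynomial σ K := X (v : σ) ^ n
  let A₀ : Ideal (MvPolynomial σ K) := Ideal.span (pow N₂ '' V₁)
  let B : Ideal (MvPolynomial σ K) := Ideal.span (pow N₂ '' V₁ᶜ)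
  have hpow : ∀ n v, pow n v = monomial (Finsupp.single (v : σ) n) 1 := fun n v =>
    X_pow_eq_monomial
  have hAB : (A₀ ⊔ I) * B ≤ I := by
    rw [Ideal.sup_mul]
    refine sup_le ?_ Ideal.mul_le_left
    rw [Ideal.span_mul_span', Ideal.span_le]
    rintro _ ⟨_, ⟨v, hv, rfl⟩, _, ⟨y, hy, rfl⟩, rfl⟩
    have hvy : (v : σ) ≠ y := fun h => hy (by rwa [← Subtype.ext h])
    have hcone : ¬ IsCone L 0 {(v : σ), (y : σ)} := fun h =>
      hy (hv.trans (SimpleGraph.Adj.reachable (G := faceGraph L) ⟨hvy, h⟩))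
    have h := hN₂ ((v : σ), (y : σ)) hvy hcone
    simp only [hpow, monomial_mul, one_mul]
    exact not_not.1 h
  have hrad : idealOfVars σ K ≤ (A₀ ⊔ I ⊔ B).radical := by
    rw [idealOfVars, Ideal.span_le]
    rintro _ ⟨x, rfl⟩
    by_cases hx : x ∈ faceVertices L
    · by_cases hx₁ : (⟨x, hx⟩ : faceVertices L) ∈ V₁
      · exact ⟨N₂, Ideal.mem_sup_left (Ideal.mem_sup_left
          (Ideal.subset_span ⟨⟨x, hx⟩, hx₁, rfl⟩))⟩
      · exact ⟨N₂, Ideal.mem_sup_right (Ideal.subset_span ⟨⟨x, hx⟩, hx₁, rfl⟩)⟩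
    · refine ⟨N₁, Ideal.mem_sup_left (Ideal.mem_sup_right ?_)⟩
      rw [X_pow_eq_monomial]
      exact not_not.1 (hN₁ x hx)
  obtain ⟨k, hk⟩ := Ideal.exists_pow_le_of_le_radical_of_fg hrad (idealOfVars_fg σ K)
  have hmem : ∀ v : faceVertices L, Finsupp.single (v : σ) N₂ ∈ L := by
    rintro ⟨v, z, hvz, hc⟩
    have := hc (Finsupp.single v N₂) (by
      intro w hw
      have := Finsupp.support_single_subset hw
      rw [Finset.mem_singleton] at this
      exact Or.inl this)
    rwa [zero_add] at this
  rcases hab.exists_notMem_of_mul_le_of_pow_le ha hb hAB hk with h | h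
  · obtain ⟨c, hc, hcI⟩ := h (pow N₂ v₀) (Ideal.mem_sup_left
      (Ideal.subset_span ⟨v₀, SimpleGraph.Reachable.refl _, rfl⟩))
    rw [hpow] at hcI
    exact hI.mul_monomial_notMem (hmem v₀) hc hcI
  · obtain ⟨c, hc, hcI⟩ := h (pow N₂ y₀) (Ideal.subset_span ⟨y₀, hne, rfl⟩)
    rw [hpow] at hcI
    exact hI.mul_monomial_notMem (hmem y₀) hc hcI

section Count

lemma coeff_mul_one_sub_X_succ (F : PowerSeries ℤ) (n : ℕ) :
    PowerSeries.coeff (n + 1) (F * (1 - PowerSeries.X)) =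
      PowerSeries.coeff (n + 1) F - PowerSeries.coeff n F := by
  rw [mul_sub, mul_one, map_sub, PowerSeries.coeff_succ_mul_X]

/-- The coefficients of `h/(1-z)` are partial sums of those of `h`, hence eventually `h(1)`; they
are the successive differences of `F`. -/
lemma coeff_eventually_affine {F : PowerSeries ℤ} {h : Polynomial ℤ}
    (hF : F * (1 - PowerSeries.X) ^ 2 = (h : PowerSeries ℤ)) :
    ∃ N, ∀ n, PowerSeries.coeff (N + n) F = PowerSeries.coeff N F + n * h.eval 1 := by
  set G := F * (1 - PowerSeries.X) with hG
  have hGh : G * (1 - PowerSeries.X) = (h : PowerSeries ℤ) := by rw [← hF]; ring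
  have h1 : ∀ n, PowerSeries.coeff n G = ∑ i ∈ Finset.range (n + 1), h.coeff i := by
    intro n
    induction n with
    | zero =>
      have := congrArg (PowerSeries.coeff 0) hGh
      rw [mul_sub, mul_one, map_sub, PowerSeries.coeff_zero_mul_X, sub_zero,
        Polynomial.coeff_coe] at this
      simpa using this
    | succ n ih =>
      rw [Finset.sum_range_succ, ← ih, ← Polynomial.coeff_coe, ← hGh,
        coeff_mul_one_sub_X_succ G]
      ring
  have h2 : ∀ n, h.natDegree ≤ n → PowerSeries.coeff n G = h.eval 1 := by
    intro n hn
    rw [h1, Polynomial.eval_eq_sum_range' (Nat.lt_succ_of_le hn)]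
    simp
  refine ⟨h.natDegree, fun n => ?_⟩
  induction n with
  | zero => simp
  | succ n ih =>
    have h3 := coeff_mul_one_sub_X_succ F (h.natDegree + n)
    rw [← hG, h2 _ (by omega), ih] at h3
    rw [← add_assoc]
    push_cast
    linarith

/-- Pairwise distinct two-dimensional cones in `L` give a linear lower bound for the number of
elements of `L` of given degree. -/
lemma exists_card_mul_le_standardCount {σ ι : Type*} [Finite σ] [Finite ι] {L : Set (σ →₀ ℕ)}
    (u : ι → σ →₀ ℕ) (x y : ι → σ) (hxy : ∀ i, x i ≠ y i) (hux : ∀ i, u i (x i) = 0)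
    (huy : ∀ i, u i (y i) = 0) (hc : ∀ i, IsCone L (u i) {x i, y i})
    (hinj : ∀ i j, u i = u j → ({x i, y i} : Set σ) = {x j, y j} → i = j) :
    ∃ B, ∀ n, Nat.card ι * (n - B) ≤ standardCount L n := by
  classical
  obtain ⟨D, hD⟩ := exists_forall_of_monotone (P := fun i n => (u i).degree ≤ n)
    (fun i m n hmn h => h.trans hmn) (fun i => ⟨_, le_rfl⟩)
  -- This margin keeps the exponents of both cone directions above `D`, which bounds all other
  -- exponents. So the pair of directions, and then the base point, can be recovered from the
  -- monomial.
  refine ⟨D + 2 * D + 2, fun n => ?_⟩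
  let Φ : ι × Fin (n - (D + 2 * D + 2)) → σ →₀ ℕ := fun p =>
    u p.1 + (Finsupp.single (x p.1) (D + 1 + p.2) +
      Finsupp.single (y p.1) (n - (u p.1).degree - (D + 1 + p.2)))
  have hx : ∀ p, Φ p (x p.1) = D + 1 + p.2 := by
    intro p
    simp [Φ, hux, (hxy p.1).symm]
  have hy : ∀ p, Φ p (y p.1) = n - (u p.1).degree - (D + 1 + p.2) := by
    intro p
    simp [Φ, huy, hxy p.1]
  have hz : ∀ p z, z ∉ ({x p.1, y p.1} : Set σ) → Φ p z = u p.1 z := by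
    intro p z hz
    simp only [Set.mem_insert_iff, Set.mem_singleton_iff, not_or] at hz
    simp [Φ, Ne.symm hz.1, Ne.symm hz.2]
  have hset : ∀ p, ({x p.1, y p.1} : Set σ) = {z | D < Φ p z} := by
    intro p
    ext z
    by_cases h : z ∈ ({x p.1, y p.1} : Set σ)
    · refine iff_of_true h ?_
      have h1 := hD p.1
      have h2 := p.2.2
      rcases h with rfl | rfl
      · change D < Φ p (x p.1)
        rw [hx]; omega
      · change D < Φ p (y p.1)
        rw [hy]; omega
    · refine iff_of_false h ?_
      change ¬ D < Φ p z
      rw [hz p z h, not_lt]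
      exact (Finsupp.le_degree z (u p.1)).trans (hD p.1)
  have hΦinj : Function.Injective Φ := by
    intro p q hpq
    have h1 : ({x p.1, y p.1} : Set σ) = {x q.1, y q.1} := by rw [hset, hset, hpq]
    have h2 : u p.1 = u q.1 := by
      ext z
      by_cases h : z ∈ ({x p.1, y p.1} : Set σ)
      · have h' := h
        rw [h1] at h'
        rcases h with rfl | rfl <;> rcases h' with h' | h' <;>
          simp only [hux, huy] <;> rw [h'] <;> simp only [hux, huy]
      · rw [← hz p z h, hpq, hz q z (h1 ▸ h)]
    have h3 := hinj _ _ h2 h1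
    refine Prod.ext h3 (Fin.ext ?_)
    have h4 := hx p
    rw [hpq, h3, hx q] at h4
    omega
  have hΦL : ∀ p, Φ p ∈ {m | m ∈ L ∧ m.degree = n} := by
    intro p
    refine ⟨hc p.1 _ fun z hz => ?_, ?_⟩
    · rcases Finset.mem_union.1 (Finsupp.support_add hz) with h | h
      · exact Or.inl (Finset.mem_singleton.1 (Finsupp.support_single_subset h))
      · exact Or.inr (Finset.mem_singleton.1 (Finsupp.support_single_subset h))
    · have h1 := hD p.1
      have h2 := p.2.2
      simp only [Φ, map_add, Finsupp.degree_single]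
      omega
  have hfin : {m | m ∈ L ∧ m.degree = n}.Finite := (finite_degree_eq n).subset fun m hm => hm.2
  calc Nat.card ι * (n - (D + 2 * D + 2)) = Nat.card (ι × Fin (n - (D + 2 * D + 2))) := by
        rw [Nat.card_prod, Nat.card_fin]
    _ = (Set.range Φ).ncard := by
        rw [← Set.image_univ, Set.ncard_image_of_injective _ hΦinj, Set.ncard_univ]
    _ ≤ _ := Set.ncard_le_ncard (by rintro _ ⟨p, rfl⟩; exact hΦL p) hfin

lemma IsMonomialIdeal.card_le_eval_one {ι : Type*} [Finite σ] [Finite ι]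
    {I : Ideal (MvPolynomial σ K)} (hI : IsMonomialIdeal I) {h : Polynomial ℤ}
    (hh : hilbertSeries I * (1 - PowerSeries.X) ^ 2 = (h : PowerSeries ℤ))
    (u : ι → σ →₀ ℕ) (x y : ι → σ) (hxy : ∀ i, x i ≠ y i) (hux : ∀ i, u i (x i) = 0)
    (huy : ∀ i, u i (y i) = 0) (hc : ∀ i, IsCone (standardExponents I) (u i) {x i, y i})
    (hinj : ∀ i j, u i = u j → ({x i, y i} : Set σ) = {x j, y j} → i = j) :
    (Nat.card ι : ℤ) ≤ h.eval 1 := by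
  obtain ⟨B, hB⟩ := exists_card_mul_le_standardCount u x y hxy hux huy hc hinj
  obtain ⟨N, hN⟩ := coeff_eventually_affine hh
  simp only [hI.hilbertSeries_eq, PowerSeries.coeff_mk] at hN
  set s := standardCount (standardExponents I)
  by_contra! hlt
  have h1 := hB (N + (s N + Nat.card ι * B + 1))
  have h2 := hN (s N + Nat.card ι * B + 1)
  -- Large enough that a slope difference of one outweighs the constant terms.
  set M := s N + Nat.card ι * B + 1 with hM
  have h3 : Nat.card ι * M ≤ s (N + M) + Nat.card ι * B := by
    calc Nat.card ι * M ≤ Nat.card ι * (N + M - B + B) := Nat.mul_le_mul_left _ (by omega)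
      _ = Nat.card ι * (N + M - B) + Nat.card ι * B := by ring
      _ ≤ _ := by omega
  have h4 : (Nat.card ι : ℤ) * M ≤ s N + M * h.eval 1 + Nat.card ι * B := by
    rw [← h2]; exact_mod_cast h3
  have h5 : (M : ℤ) = s N + Nat.card ι * B + 1 := by exact_mod_cast hM
  have h6 : (M : ℤ) * (h.eval 1 + 1) ≤ M * Nat.card ι :=
    mul_le_mul_of_nonneg_left (by omega) (by omega)
  linarith

end Count

end

/-! ### The standard monomials of a tree ideal, and the passage from the ring to the tree. -/

section

section Description

variable {σ : Type*} {V : Set σ}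

/-- The variables that are end points of an edge. -/
def endpoints (e : Sym2 V) : Set σ := Subtype.val '' {v | v ∈ e}

lemma endpoints_mk (x y : V) : endpoints s(x, y) = {(x : σ), (y : σ)} := by
  ext z
  simp only [endpoints, Set.mem_image, Set.mem_ofPred_eq, Sym2.mem_iff, Set.mem_insert_iff,
    Set.mem_singleton_iff]
  constructor
  · rintro ⟨v, rfl | rfl, rfl⟩ <;> simp
  · rintro (rfl | rfl)
    · exact ⟨x, Or.inl rfl, rfl⟩
    · exact ⟨y, Or.inr rfl, rfl⟩

lemma endpoints_subset (e : Sym2 V) : endpoints e ⊆ V := by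
  rintro _ ⟨v, _, rfl⟩
  exact v.2

lemma coe_mem_endpoints {e : Sym2 V} {v : V} : (v : σ) ∈ endpoints e ↔ v ∈ e := by
  constructor
  · rintro ⟨w, hw, h⟩
    rwa [← Subtype.ext h]
  · exact fun h => ⟨v, h, rfl⟩

lemma endpoints_injective : Function.Injective (endpoints (V := V)) := by
  intro e e' h
  refine Sym2.ext fun v => ?_
  rw [← coe_mem_endpoints, h, coe_mem_endpoints]

/-- The exponents of the monomials outside the ideal of a tree. -/
def treeExponents (G : SimpleGraph V) (φ : (Vᶜ : Set σ) → G.edgeSet) : Set (σ →₀ ℕ) :=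
  {m | (∃ e ∈ G.edgeSet, (m.support : Set σ) ⊆ endpoints e) ∨
    ∃ q : (Vᶜ : Set σ), ∃ m' : σ →₀ ℕ, (m'.support : Set σ) ⊆ endpoints (φ q : Sym2 V) ∧
      m = Finsupp.single (q : σ) 1 + m'}

/-- The exponents of the generators of the ideal of a tree. -/
def treeGenerators (G : SimpleGraph V) (φ : (Vᶜ : Set σ) → G.edgeSet) : Set (σ →₀ ℕ) :=
  ({m | ∃ x y : V, x ≠ y ∧ ¬ G.Adj x y ∧ m = Finsupp.single (x : σ) 1 + Finsupp.single (y : σ) 1} ∪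
    {m | ∃ x y z : V, x ≠ y ∧ x ≠ z ∧ y ≠ z ∧ m = Finsupp.single (x : σ) 1 +
      Finsupp.single (y : σ) 1 + Finsupp.single (z : σ) 1}) ∪
  ({m | ∃ x y : (Vᶜ : Set σ), m = Finsupp.single (x : σ) 1 + Finsupp.single (y : σ) 1} ∪
    {m | ∃ (x : (Vᶜ : Set σ)) (y : V), y ∉ (φ x : Sym2 V) ∧
      m = Finsupp.single (x : σ) 1 + Finsupp.single (y : σ) 1})

variable (K : Type*) [Field K]

lemma treeIdeal_eq_span (G : SimpleGraph V) (φ : (Vᶜ : Set σ) → G.edgeSet) :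
    treeIdeal K G φ = Ideal.span ((fun a => monomial a (1 : K)) '' treeGenerators G φ) := by
  have h2 : ∀ x y : σ, monomial (Finsupp.single x 1 + Finsupp.single y 1) (1 : K) = X x * X y :=
    fun x y => by rw [X, X, monomial_mul, one_mul]
  have h3 : ∀ x y z : σ, monomial (Finsupp.single x 1 + Finsupp.single y 1 +
      Finsupp.single z 1) (1 : K) = X x * X y * X z :=
    fun x y z => by rw [X, X, X, monomial_mul, monomial_mul, one_mul, one_mul]
  rw [treeIdeal, graphIdeal, extraIdeal, pow_two, Ideal.span_mul_span', ← Ideal.span_union,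
    ← Ideal.span_union]
  congr 1
  rw [treeGenerators, Set.image_union, Set.image_union, Set.image_union]
  congr 1
  · congr 1
    · ext f
      constructor
      · rintro ⟨x, y, h, h', rfl⟩
        exact ⟨_, ⟨x, y, h, h', rfl⟩, h2 _ _⟩
      · rintro ⟨_, ⟨x, y, h, h', rfl⟩, rfl⟩
        exact ⟨x, y, h, h', h2 _ _⟩
    · ext f
      constructor
      · rintro ⟨x, y, z, h, h', h'', rfl⟩
        exact ⟨_, ⟨x, y, z, h, h', h'', rfl⟩, h3 _ _ _⟩
      · rintro ⟨_, ⟨x, y, z, h, h', h'', rfl⟩, rfl⟩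
        exact ⟨x, y, z, h, h', h'', h3 _ _ _⟩
  · congr 1
    · ext f
      constructor
      · rintro ⟨_, ⟨x, hx, rfl⟩, _, ⟨y, hy, rfl⟩, rfl⟩
        exact ⟨_, ⟨⟨x, hx⟩, ⟨y, hy⟩, rfl⟩, h2 _ _⟩
      · rintro ⟨_, ⟨x, y, rfl⟩, rfl⟩
        exact ⟨_, ⟨x, x.2, rfl⟩, _, ⟨y, y.2, rfl⟩, (h2 _ _).symm⟩
    · ext f
      constructor
      · rintro ⟨x, y, h, rfl⟩
        exact ⟨_, ⟨x, y, h, rfl⟩, h2 _ _⟩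
      · rintro ⟨_, ⟨x, y, h, rfl⟩, rfl⟩
        exact ⟨x, y, h, h2 _ _⟩

lemma isMonomialIdeal_treeIdeal (G : SimpleGraph V) (φ : (Vᶜ : Set σ) → G.edgeSet) :
    IsMonomialIdeal (treeIdeal K G φ) := ⟨_, treeIdeal_eq_span K G φ⟩

lemma mem_standardExponents_treeIdeal {G : SimpleGraph V} {φ : (Vᶜ : Set σ) → G.edgeSet}
    {m : σ →₀ ℕ} : m ∈ standardExponents (treeIdeal K G φ) ↔ ∀ a ∈ treeGenerators G φ, ¬ a ≤ m := by
  classical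
  rw [standardExponents, Set.mem_ofPred_eq, treeIdeal_eq_span, mem_ideal_span_monomial_image]
  simp [support_monomial]

/-- A standard monomial has at most one factor from `Q`, and its vertices form a clique of size at
most two, contained in `φ(q)` if `q` occurs. Absence of isolated vertices puts the powers of a
single vertex on an edge; a nonempty edge set does so for the monomial `1`. -/
lemma standardExponents_treeIdeal (G : SimpleGraph V) (φ : (Vᶜ : Set σ) → G.edgeSet)
    (hG : ∀ x, ∃ y, G.Adj x y) (hE : G.edgeSet.Nonempty) :
    standardExponents (treeIdeal K G φ) = treeExponents G φ := by
  classical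
  ext m
  rw [mem_standardExponents_treeIdeal]
  constructor
  · intro h
    have hle2 : ∀ x y : σ, x ≠ y → m x ≠ 0 → m y ≠ 0 →
        Finsupp.single x 1 + Finsupp.single y 1 ≤ m := by
      intro x y hxy hx hy z
      by_cases hzx : z = x
      · subst hzx; simp [hxy.symm]; omega
      · by_cases hzy : z = y
        · subst hzy; simp [hxy]; omega
        · simp [Ne.symm hzx, Ne.symm hzy]
    have hle3 : ∀ x y z : σ, x ≠ y → x ≠ z → y ≠ z → m x ≠ 0 → m y ≠ 0 → m z ≠ 0 →
        Finsupp.single x 1 + Finsupp.single y 1 + Finsupp.single z 1 ≤ m := by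
      intro x y z hxy hxz hyz hx hy hz w
      have h1 := hle2 x y hxy hx hy w
      by_cases hw : w = z
      · subst hw; simp [hxz, hyz]; omega
      · simpa [Ne.symm hw] using h1
    have hadj : ∀ x y : V, x ≠ y → m x ≠ 0 → m y ≠ 0 → G.Adj x y := by
      intro x y hxy hx hy
      by_contra hn
      exact h _ (Or.inl (Or.inl ⟨x, y, hxy, hn, rfl⟩))
        (hle2 _ _ (fun h => hxy (Subtype.ext h)) hx hy)
    have htri : ∀ x y z : V, x ≠ y → x ≠ z → y ≠ z → m x ≠ 0 → m y ≠ 0 → m z = 0 := by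
      intro x y z hxy hxz hyz hx hy
      by_contra hz
      exact h _ (Or.inl (Or.inr ⟨x, y, z, hxy, hxz, hyz, rfl⟩))
        (hle3 _ _ _ (fun h => hxy (Subtype.ext h)) (fun h => hxz (Subtype.ext h))
          (fun h => hyz (Subtype.ext h)) hx hy hz)
    by_cases hq : ∃ q ∉ V, m q ≠ 0
    · obtain ⟨q, hqV, hq⟩ := hq
      have hq1 : m q = 1 := by
        by_contra hne
        refine h _ (Or.inr (Or.inl ⟨⟨q, hqV⟩, ⟨q, hqV⟩, rfl⟩)) ?_
        rw [← Finsupp.single_add, Finsupp.single_le_iff]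
        change 2 ≤ m q
        omega
      refine Or.inr ⟨⟨q, hqV⟩, m.erase q, fun z hz => ?_, ?_⟩
      · rw [Finset.mem_coe, Finsupp.support_erase, Finset.mem_erase, Finsupp.mem_support_iff] at hz
        by_cases hzV : z ∈ V
        · change ((⟨z, hzV⟩ : V) : σ) ∈ _
          rw [coe_mem_endpoints]
          by_contra hn
          exact h _ (Or.inr (Or.inr ⟨⟨q, hqV⟩, ⟨z, hzV⟩, hn, rfl⟩)) (hle2 _ _ hz.1.symm hq hz.2)
        · exact (h _ (Or.inr (Or.inl ⟨⟨q, hqV⟩, ⟨z, hzV⟩, rfl⟩)) (hle2 _ _ hz.1.symm hq hz.2)).elim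
      · rw [← hq1, Finsupp.single_add_erase]
    · push Not at hq
      have hV : ∀ z, m z ≠ 0 → z ∈ V := fun z hz => by
        by_contra hn
        exact hz (hq z hn)
      left
      by_cases hm : ∃ x : V, m x ≠ 0
      · obtain ⟨x, hx⟩ := hm
        by_cases hm2 : ∃ y : V, y ≠ x ∧ m y ≠ 0
        · obtain ⟨y, hyx, hy⟩ := hm2
          refine ⟨s(x, y), hadj x y hyx.symm hx hy, fun z hz => ?_⟩
          have hz' := Finsupp.mem_support_iff.1 hz
          rw [endpoints_mk]
          by_contra hn
          simp only [Set.mem_insert_iff, Set.mem_singleton_iff, not_or] at hn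
          exact hz' (htri x y ⟨z, hV z hz'⟩ hyx.symm (fun h => hn.1 (congrArg Subtype.val h).symm)
            (fun h => hn.2 (congrArg Subtype.val h).symm) hx hy)
        · push Not at hm2
          obtain ⟨y, hxy⟩ := hG x
          refine ⟨s(x, y), hxy, fun z hz => ?_⟩
          have hz' := Finsupp.mem_support_iff.1 hz
          rw [endpoints_mk]
          left
          by_contra hn
          exact hz' (hm2 ⟨z, hV z hz'⟩ fun h => hn (congrArg Subtype.val h))
      · push Not at hm
        obtain ⟨e, he⟩ := hE
        refine ⟨e, he, fun z hz => ?_⟩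
        have hz' := Finsupp.mem_support_iff.1 hz
        exact (hz' (hm ⟨z, hV z hz'⟩)).elim
  · intro hm a ha ham
    have key : ∃ e ∈ G.edgeSet, ∀ x : V, m x ≠ 0 → x ∈ e := by
      rcases hm with ⟨e, he, hme⟩ | ⟨q, m', hm', rfl⟩
      · exact ⟨e, he, fun x hx => coe_mem_endpoints.1 (hme (Finsupp.mem_support_iff.2 hx))⟩
      · refine ⟨_, (φ q).2, fun x hx => coe_mem_endpoints.1 (hm' (Finsupp.mem_support_iff.2 ?_))⟩
        have hqx : (q : σ) ≠ x := fun h => q.2 (h ▸ x.2)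
        simpa [hqx] using hx
    have hne : ∀ x, a x ≠ 0 → m x ≠ 0 := fun x hx => by have := ham x; omega
    obtain ⟨e, he, hme⟩ := key
    rcases ha with (⟨x, y, hxy, hadj, rfl⟩ | ⟨x, y, z, hxy, hxz, hyz, rfl⟩) |
      ⟨p, q, rfl⟩ | ⟨q, x, hx, rfl⟩
    · have h1 := hme x (hne _ (by simp))
      have h2 := hme y (hne _ (by simp))
      rw [(Sym2.mem_and_mem_iff hxy).1 ⟨h1, h2⟩] at he
      exact hadj he
    · have h1 := hme x (hne _ (by simp))
      have h2 := hme y (hne _ (by simp))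
      have h3 := hme z (hne _ (by simp))
      rw [(Sym2.mem_and_mem_iff hxy).1 ⟨h1, h2⟩, Sym2.mem_iff] at h3
      exact h3.elim (fun h => hxz h.symm) (fun h => hyz h.symm)
    · rcases hm with ⟨e, he, hme⟩ | ⟨r, m', hm', rfl⟩
      · exact p.2 (endpoints_subset e (hme (Finsupp.mem_support_iff.2 (hne _ (by simp)))))
      · have hr : ∀ s : (Vᶜ : Set σ), m' s = 0 := fun s => by
          by_contra hs
          exact s.2 (endpoints_subset _ (hm' (Finsupp.mem_support_iff.2 hs)))
        have hp := ham p
        have hq := ham q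
        by_cases hpq : (p : σ) = q
        · rw [hpq] at hp
          by_cases hrq : (r : σ) = q <;> simp [hr, hrq] at hp
        · by_cases hrp : (r : σ) = p
          · have : (r : σ) ≠ q := hrp ▸ hpq
            simp [hr, hpq, this] at hq
          · simp [hr, Ne.symm hpq, hrp] at hp
    · rcases hm with ⟨e, he, hme⟩ | ⟨r, m', hm', rfl⟩
      · exact q.2 (endpoints_subset e (hme (Finsupp.mem_support_iff.2 (hne _ (by simp)))))
      · have hq : m' q = 0 := by
          by_contra hs
          exact q.2 (endpoints_subset _ (hm' (Finsupp.mem_support_iff.2 hs)))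
        have hqr : r = q := by
          by_contra h
          have := ham q
          have h' : (r : σ) ≠ q := fun h'' => h (Subtype.ext h'')
          simp [hq, h'] at this
        subst hqr
        refine hx (coe_mem_endpoints.1 (hm' (Finsupp.mem_support_iff.2 ?_)))
        have hrx : (r : σ) ≠ x := fun h => r.2 (h ▸ x.2)
        have := hne x (by simp)
        simpa [hrx] using this

end Description

variable {σ K : Type*} [Field K]

/-- A monomial ideal with Cohen-Macaulay quotient of dimension two and minimal multiplicity is the
ideal of a tree. -/
theorem IsMonomialIdeal.exists_eq_treeIdeal [Finite σ] {I : Ideal (MvPolynomial σ K)}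
    (hI : IsMonomialIdeal I) (hdim : ringKrullDim (MvPolynomial σ K ⧸ I) = 2)
    (hCM : IsCohenMacaulay (MvPolynomial σ K ⧸ I)) (hmult : HasMinimalMultiplicity I) :
    ∃ (V : Set σ) (G : SimpleGraph V) (φ : (Vᶜ : Set σ) → G.edgeSet),
      G.IsTree ∧ G.edgeSet.Nonempty ∧ I = treeIdeal K G φ := by
  classical
  obtain ⟨a, ha, b, hb, hab⟩ := hI.exists_isRegularPairAt hdim hCM
  obtain ⟨hlin, c, hc, h, ⟨d, hd, hh⟩, hh1⟩ := hmult
  have hd2 : d = 2 := by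
    rw [hdim] at hd
    exact_mod_cast hd.symm
  subst hd2
  have hcard : Nat.card σ = c + 2 := by
    rw [HasCodimension, hdim, MvPolynomial.ringKrullDim_of_isNoetherianRing,
      ringKrullDim_eq_zero_of_field, zero_add] at hc
    have : Nat.card σ = 2 + c := by exact_mod_cast hc
    omega
  set L := standardExponents I with hLdef
  have hL : IsLowerSet L := isLowerSet_standardExponents I
  have h3 : ∀ T : Finset σ, IsCone L 0 T → T.card ≤ 2 := by
    intro T hT
    have := le_ringKrullDim_quotient hI T fun m hm => by simpa using hT m (by exact_mod_cast hm)
    rw [hdim] at this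
    exact_mod_cast this
  have hcov : ∀ u ∈ L, ∃ x y : faceVertices L, (faceGraph L).Adj x y ∧
      IsCone L u {(x : σ), (y : σ)} := by
    intro u hu
    obtain ⟨x, y, hxy, hc⟩ := hI.exists_isCone ha hb hab hu
    have h0 : IsCone L 0 {x, y} := hc.mono hL zero_le
    exact ⟨⟨x, y, hxy, h0⟩, ⟨y, x, hxy.symm, by rwa [Set.pair_comm]⟩, ⟨hxy, h0⟩, hc⟩
  obtain ⟨x₀, y₀, hxy₀, hc₀⟩ := exists_isCone_pair hdim.ge
  have hE : (faceGraph L).edgeSet.Nonempty :=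
    ⟨s(⟨x₀, y₀, hxy₀, hc₀⟩, ⟨y₀, x₀, hxy₀.symm, by rwa [Set.pair_comm]⟩), hxy₀, hc₀⟩
  have hconn : (faceGraph L).Connected :=
    { preconnected := hI.preconnected_faceGraph ha hb hab h3
      nonempty := ⟨⟨x₀, y₀, hxy₀, hc₀⟩⟩ }
  -- As `I` has no linear forms, `e_q` is standard; the directions of a cone at `e_q` form the edge
  -- chosen as `φ(q)`.
  choose ex ey hadj hcq using fun q : ((faceVertices L)ᶜ : Set σ) =>
    hcov _ (single_mem_standardExponents hlin (q : σ))
  let φ : ((faceVertices L)ᶜ : Set σ) → (faceGraph L).edgeSet := fun q => ⟨s(ex q, ey q), hadj q⟩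
  have hrep : ∀ e : (faceGraph L).edgeSet, ∃ x y, (faceGraph L).Adj x y ∧ e.1 = s(x, y) := by
    rintro ⟨e, he⟩
    induction e with
    | h x y => exact ⟨x, y, he, rfl⟩
  choose fx fy hfadj hf using hrep
  let ι := (faceGraph L).edgeSet ⊕ ((faceVertices L)ᶜ : Set σ)
  let u : ι → σ →₀ ℕ := Sum.elim (fun _ => 0) fun q => Finsupp.single (q : σ) 1
  let x : ι → faceVertices L := Sum.elim fx ex
  let y : ι → faceVertices L := Sum.elim fy ey
  have hxy : ∀ i, (x i : σ) ≠ y i := by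
    rintro (e | q)
    · exact (hfadj e).1
    · exact (hadj q).1
  have hu0 : ∀ i, ∀ v : faceVertices L, u i v = 0 := by
    rintro (e | q) v
    · rfl
    · have : (q : σ) ≠ v := fun h => q.2 (h ▸ v.2)
      simp [u, this]
  have huc : ∀ i, IsCone L (u i) {(x i : σ), (y i : σ)} := by
    rintro (e | q)
    · exact (hfadj e).2
    · exact hcq q
  have hinj : ∀ i j, u i = u j → ({(x i : σ), (y i : σ)} : Set σ) = {(x j : σ), (y j : σ)} →
      i = j := by
    rintro (e | q) (e' | q') h1 h2
    · congr 1
      refine Subtype.ext (endpoints_injective ?_)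
      rw [hf, hf, endpoints_mk, endpoints_mk]
      exact h2
    · simp [u, eq_comm] at h1
    · simp [u] at h1
    · have := (Finsupp.single_left_inj (one_ne_zero)).1 h1
      rw [Subtype.ext this]
  have hcount := hI.card_le_eval_one hh u (fun i => (x i : σ)) (fun i => (y i : σ)) hxy
    (fun i => hu0 i _) (fun i => hu0 i _) huc hinj
  have hι : Nat.card ι = Nat.card (faceGraph L).edgeSet + Nat.card ((faceVertices L)ᶜ : Set σ) :=
    Nat.card_sum
  have hσ : Nat.card (faceVertices L) + Nat.card ((faceVertices L)ᶜ : Set σ) = Nat.card σ := by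
    rw [← Nat.card_sum]
    exact Nat.card_congr (Equiv.Set.sumCompl _)
  have hle := hconn.card_vert_le_card_edgeSet_add_one
  have hcount' : Nat.card ι ≤ c + 1 := by rw [hh1] at hcount; exact_mod_cast hcount
  -- The bounds `|E| + |Q| ≤ c + 1`, `|V| ≤ |E| + 1` and `|V| + |Q| = c + 2` force `|V| = |E| + 1`.
  have htree : (faceGraph L).IsTree :=
    SimpleGraph.isTree_iff_connected_and_card.2 ⟨hconn, by omega⟩
  have hneigh : ∀ x, ∃ y, (faceGraph L).Adj x y := by
    rintro ⟨x, y, hxy, hc⟩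
    exact ⟨⟨y, x, hxy.symm, by rwa [Set.pair_comm]⟩, hxy, hc⟩
  refine ⟨faceVertices L, faceGraph L, φ, htree, hE,
    hI.ext (isMonomialIdeal_treeIdeal K _ φ) ?_⟩
  rw [standardExponents_treeIdeal K _ φ hneigh hE]
  ext m
  constructor
  · intro hm
    obtain ⟨p, r, hpr, hcm⟩ := hcov m hm
    -- Moving the base point back along the two directions normalizes the cone, so that it can be
    -- compared with the listed ones.
    set m' := (m.erase (p : σ)).erase (r : σ) with hm'
    have hm'le : m' ≤ m := by
      intro z
      simp only [hm', Finsupp.erase_apply]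
      split_ifs <;> omega
    have hm'p : m' p = 0 := by simp [hm', Finsupp.erase_apply]
    have hm'r : m' r = 0 := by simp [hm']
    have hmm' : m = m' + (m - m') := (add_tsub_cancel_of_le hm'le).symm
    have hsub : ((m - m').support : Set σ) ⊆ {(p : σ), (r : σ)} := by
      intro z hz
      by_contra hn
      simp only [Set.mem_insert_iff, Set.mem_singleton_iff, not_or] at hn
      simp [hm', hn.1, hn.2] at hz
    by_cases hex : ∃ i, u i = m' ∧ ({(x i : σ), (y i : σ)} : Set σ) = {(p : σ), (r : σ)}
    · obtain ⟨i | q, hi, hi2⟩ := hex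
      · left
        refine ⟨s(p, r), hpr, ?_⟩
        rw [endpoints_mk]
        have : m' = 0 := hi.symm
        rwa [this, tsub_zero] at hsub
      · right
        refine ⟨q, m - m', ?_, ?_⟩
        · change _ ⊆ endpoints s(ex q, ey q)
          rw [endpoints_mk]
          exact hi2 ▸ hsub
        · rw [hmm']
          congr 1
          · exact hi.symm
          · rw [← hmm']
    · exfalso
      push Not at hex
      -- The listed cones already exhaust the multiplicity `c + 1`, so there is no room for another.
      have h1 := hI.card_le_eval_one hh (ι := Option ι) (fun i => i.elim m' u)
        (fun i => i.elim (p : σ) fun i => (x i : σ)) (fun i => i.elim (r : σ) fun i => (y i : σ))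
        (fun i => by cases i; exacts [hpr.1, hxy _])
        (fun i => by cases i; exacts [hm'p, hu0 _ _])
        (fun i => by cases i; exacts [hm'r, hu0 _ _])
        (fun i => by cases i; exacts [hcm.mono hL hm'le, huc _])
        (by
          rintro (_ | i) (_ | j) h1 h2
          · rfl
          · exact (hex j h1.symm h2.symm).elim
          · exact (hex i h1 h2).elim
          · exact congrArg some (hinj i j h1 h2))
      rw [hh1, Finite.card_option] at h1
      have : Nat.card ι + 1 ≤ c + 1 := by exact_mod_cast h1
      omega
  · rintro (⟨e, he, hme⟩ | ⟨q, m', hm', rfl⟩)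
    · rw [show e = s(fx ⟨e, he⟩, fy ⟨e, he⟩) from hf ⟨e, he⟩, endpoints_mk] at hme
      simpa using (hfadj ⟨e, he⟩).2 m hme
    · refine hcq q m' ?_
      rw [← endpoints_mk]
      exact hm'

end

/-! ### Building the standard monomials of a tree ideal one shifted plane at a time. -/

section

section Tree

variable {W : Type*} {G : SimpleGraph W}

lemma exists_adj_dist_lt (hG : G.Connected) {r v : W} (hv : v ≠ r) :
    ∃ w, G.Adj v w ∧ G.dist r w < G.dist r v := by
  obtain ⟨p, hp⟩ := hG.exists_walk_length_eq_dist v r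
  cases p with
  | nil => exact (hv rfl).elim
  | @cons _ w _ h q =>
    refine ⟨w, h, ?_⟩
    rw [G.dist_comm (u := r), G.dist_comm (u := r), ← hp, SimpleGraph.Walk.length_cons]
    exact Nat.lt_succ_of_le (SimpleGraph.dist_le q)

/-- Uniqueness of the parent: each such neighbour is the second vertex of a path from `v` to the
root, and a tree has only one. -/
lemma eq_of_adj_of_dist_lt (hG : G.IsTree) {r v w w' : W} (h : G.Adj v w) (h' : G.Adj v w')
    (hd : G.dist r w < G.dist r v) (hd' : G.dist r w' < G.dist r v) : w = w' := by
  have key : ∀ w, G.Adj v w → G.dist r w < G.dist r v → ∃ p : G.Walk v r, p.IsPath ∧ p.snd = w := by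
    intro w h hd
    obtain ⟨p, hp⟩ := hG.connected.exists_walk_length_eq_dist w r
    refine ⟨SimpleGraph.Walk.cons h p, ?_, by simp⟩
    apply SimpleGraph.Walk.isPath_of_length_eq_dist
    rw [SimpleGraph.Walk.length_cons, hp, G.dist_comm (u := w), G.dist_comm (u := v)]
    rcases hG.dist_eq_dist_add_one_of_adj r h with h1 | h1 <;> omega
  obtain ⟨p, hp, rfl⟩ := key w h hd
  obtain ⟨p', hp', rfl⟩ := key w' h' hd'
  rw [(hG.existsUnique_path v r).unique hp hp']

end Tree

/-- Sets of exponents obtained from a coordinate cone with support in a member of `F` by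
successively adding a new variable `a` and a shifted cone `e_a + ℕ^T` with `T ∈ F`. -/
inductive ConeChain {σ : Type*} (F : Set (Set σ)) : Set (σ →₀ ℕ) → ℕ → Prop
  | base (T : Set σ) (hT : T ∈ F) : ConeChain F {m | (m.support : Set σ) ⊆ T} 0
  | step (L : Set (σ →₀ ℕ)) (a : σ) (T : Set σ) (k : ℕ) (hT : T ∈ F) (hL : IsLowerSet L)
      (ha : ∀ m : σ →₀ ℕ, Finsupp.single a 1 + m ∈ L ↔ (m.support : Set σ) ⊆ T)
      (h : ConeChain F {m | m ∈ L ∧ m a = 0} k) : ConeChain F L (k + 1)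

variable {σ : Type*} {V : Set σ}

lemma isLowerSet_treeExponents (G : SimpleGraph V) (φ : (Vᶜ : Set σ) → G.edgeSet)
    (hG : ∀ x, ∃ y, G.Adj x y) (hE : G.edgeSet.Nonempty) :
    IsLowerSet (treeExponents G φ) := by
  -- The set does not depend on a field; `ℚ` is an arbitrary choice.
  rw [← standardExponents_treeIdeal ℚ G φ hG hE]
  exact isLowerSet_standardExponents _

lemma single_add_mem_treeExponents {G : SimpleGraph V} {φ : (Vᶜ : Set σ) → G.edgeSet}
    (q : (Vᶜ : Set σ)) {m : σ →₀ ℕ} : Finsupp.single (q : σ) 1 + m ∈ treeExponents G φ ↔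
      (m.support : Set σ) ⊆ endpoints (φ q : Sym2 V) := by
  constructor
  · rintro (⟨e, he, hm⟩ | ⟨q', m', hm', h⟩)
    · exact (q.2 (endpoints_subset e (hm (by simp)))).elim
    · have hm'q : m' q = 0 := by
        by_contra hs
        exact q.2 (endpoints_subset _ (hm' (Finsupp.mem_support_iff.2 hs)))
      have hqq : q' = q := by
        by_contra hne
        have h1 := DFunLike.congr_fun h (q : σ)
        have hne' : (q' : σ) ≠ q := fun h => hne (Subtype.ext h)
        simp [hm'q, hne'] at h1
      subst hqq
      rwa [add_left_cancel h]
  · exact fun h => Or.inr ⟨q, m, h, rfl⟩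

/-- Starting from the edge `r r'`, the other vertices are added by distance from `r`, and the
variables of `Q` last. A new vertex brings the plane of the edge to its parent, a new `q` the plane
of `φ(q)`. -/
theorem coneChain_treeExponents [Finite σ] {G : SimpleGraph V} (hG : G.IsTree)
    (hE : G.edgeSet.Nonempty) (φ : (Vᶜ : Set σ) → G.edgeSet) :
    ∃ k, k + 2 = Nat.card σ ∧
      ConeChain {T | ∃ e ∈ G.edgeSet, T = endpoints e} (treeExponents G φ) k := by
  classical
  have := Fintype.ofFinite σ
  obtain ⟨e₀, he₀⟩ := hE
  induction e₀ with
  | h r r' =>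
  have hrr' : G.Adj r r' := he₀
  have hne : (r : σ) ≠ r' := fun h => hrr'.ne (Subtype.ext h)
  have hneigh : ∀ x, ∃ y, G.Adj x y := by
    intro x
    by_cases h : x = r
    · exact ⟨r', h ▸ hrr'⟩
    · obtain ⟨w, hw, _⟩ := exists_adj_dist_lt hG.connected h
      exact ⟨w, hw⟩
  have hlow := isLowerSet_treeExponents G φ hneigh ⟨_, he₀⟩
  obtain ⟨M, hM⟩ := exists_forall_of_monotone (P := fun (v : V) n => G.dist r v < n)
    (fun v m n hmn h => h.trans_le hmn) (fun v => ⟨_, Nat.lt_succ_self _⟩)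
  let rank : σ → ℕ := fun z => if h : z ∈ V then G.dist r ⟨z, h⟩ else M
  have hrankV : ∀ v : V, rank v = G.dist r v := fun v => dif_pos v.2
  have hrankQ : ∀ q ∉ V, rank q = M := fun q hq => dif_neg hq
  let Lof : Finset σ → Set (σ →₀ ℕ) := fun s =>
    {m | m ∈ treeExponents G φ ∧ (m.support : Set σ) ⊆ (s : Set σ) ∪ {(r : σ), (r' : σ)}}
  -- Parents and the end points of `φ(q)` must be present already. Both have smaller rank, so
  -- removing an element of maximal rank keeps the condition.
  let closed : Finset σ → Prop := fun s =>
    (∀ v w : V, (v : σ) ∈ s → G.Adj v w → G.dist r w < G.dist r v →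
      (w : σ) ∈ (s : Set σ) ∪ {(r : σ), (r' : σ)}) ∧
    ∀ q : (Vᶜ : Set σ), (q : σ) ∈ s → endpoints (φ q : Sym2 V) ⊆
      (s : Set σ) ∪ {(r : σ), (r' : σ)}
  have main : ∀ s : Finset σ, (r : σ) ∉ s → (r' : σ) ∉ s → closed s →
      ConeChain {T | ∃ e ∈ G.edgeSet, T = endpoints e} (Lof s) s.card := by
    intro s
    induction s using Finset.induction_on_max_value rank with
    | empty =>
      intro _ _ _
      convert ConeChain.base (F := {T | ∃ e ∈ G.edgeSet, T = endpoints e})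
        (endpoints s(r, r')) ⟨_, he₀, rfl⟩ using 1
      · ext m
        rw [endpoints_mk]
        constructor
        · exact fun h => by simpa using h.2
        · intro h
          refine ⟨Or.inl ⟨_, he₀, ?_⟩, by simpa using h⟩
          rw [endpoints_mk]
          exact h
      · rfl
    | insert a s has hmax ih =>
      intro hr hr' hcl
      rw [Finset.mem_insert, not_or] at hr hr'
      have hcls : closed s := by
        refine ⟨fun v w hv hvw hd => ?_, fun q hq z hz => ?_⟩
        · have h1 := hcl.1 v w (Finset.mem_insert_of_mem hv) hvw hd
          rw [Finset.coe_insert, Set.insert_union] at h1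
          refine h1.resolve_left fun h => ?_
          have h2 := hmax v hv
          rw [← h, hrankV, hrankV] at h2
          omega
        · have h1 := hcl.2 q (Finset.mem_insert_of_mem hq) hz
          rw [Finset.coe_insert, Set.insert_union] at h1
          refine h1.resolve_left fun h => ?_
          have h2 := hmax q hq
          have h3 := hM ⟨z, endpoints_subset _ hz⟩
          have h4 := hrankV ⟨z, endpoints_subset _ hz⟩
          rw [← h, hrankQ q q.2] at h2
          change rank z = _ at h4
          omega
      have hlowL : IsLowerSet (Lof (insert a s)) := fun m m' hle hm =>
        ⟨hlow hle hm.1, fun z hz => hm.2 (Finsupp.support_mono hle hz)⟩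
      have hL0 : {m | m ∈ Lof (insert a s) ∧ m a = 0} = Lof s := by
        ext m
        constructor
        · rintro ⟨⟨h1, h2⟩, h3⟩
          refine ⟨h1, fun z hz => ?_⟩
          have h4 := h2 hz
          rw [Finset.coe_insert, Set.insert_union] at h4
          refine h4.resolve_left fun h => ?_
          rw [h] at hz
          exact Finsupp.mem_support_iff.1 hz h3
        · rintro ⟨h1, h2⟩
          refine ⟨⟨h1, fun z hz => ?_⟩, ?_⟩
          · rw [Finset.coe_insert, Set.insert_union]
            exact Or.inr (h2 hz)
          · by_contra h
            rcases h2 (Finsupp.mem_support_iff.2 h) with h | h | h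
            · exact has h
            · exact hr.1 h.symm
            · exact hr'.1 h.symm
      have hsupp : ∀ m : σ →₀ ℕ, (m.support : Set σ) ⊆
          ((insert a s : Finset σ) : Set σ) ∪ {(r : σ), (r' : σ)} →
          ((Finsupp.single a 1 + m).support : Set σ) ⊆
          ((insert a s : Finset σ) : Set σ) ∪ {(r : σ), (r' : σ)} := by
        intro m hm z hz
        rcases Finset.mem_union.1 (Finsupp.support_add hz) with h | h
        · rw [Finset.mem_singleton.1 (Finsupp.support_single_subset h)]
          exact Or.inl (by simp)
        · exact hm h
      have hsupp' : ∀ m : σ →₀ ℕ, (m.support : Set σ) ⊆ (Finsupp.single a 1 + m).support := by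
        intro m
        exact_mod_cast Finsupp.support_mono le_add_self
      rw [Finset.card_insert_of_notMem has]
      by_cases haV : a ∈ V
      · have har : (⟨a, haV⟩ : V) ≠ r := fun h => hr.1 (congrArg Subtype.val h).symm
        obtain ⟨w, hvw, hdw⟩ := exists_adj_dist_lt hG.connected har
        have hT : ∀ m : σ →₀ ℕ, Finsupp.single a 1 + m ∈ Lof (insert a s) ↔
            (m.support : Set σ) ⊆ endpoints s(⟨a, haV⟩, w) := by
          intro m
          constructor
          · rintro ⟨⟨e, he, hm⟩ | ⟨q, m', hm', h⟩, hms⟩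
            · intro z hz
              have hze := hm (hsupp' m hz)
              have hae : a ∈ endpoints e := hm (by simp)
              rw [endpoints_mk]
              by_cases hza : z = a
              · exact Or.inl hza
              · right
                have hzV := endpoints_subset e hze
                have hadj : G.Adj ⟨a, haV⟩ ⟨z, hzV⟩ := by
                  have := (Sym2.mem_and_mem_iff (z := e)
                    (fun h => hza (congrArg Subtype.val h).symm :
                      (⟨a, haV⟩ : V) ≠ ⟨z, hzV⟩)).1
                    ⟨coe_mem_endpoints.1 hae, coe_mem_endpoints.1 hze⟩
                  rw [this] at he
                  exact he
                have hle : G.dist r ⟨z, hzV⟩ ≤ G.dist r ⟨a, haV⟩ := by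
                  have h1 := hms (hsupp' m hz)
                  rw [Finset.coe_insert, Set.insert_union] at h1
                  rcases h1.resolve_left hza with h | h | h
                  · have := hmax z h
                    rwa [show rank z = _ from hrankV ⟨z, hzV⟩,
                      show rank a = _ from hrankV ⟨a, haV⟩] at this
                  · have : (⟨z, hzV⟩ : V) = r := Subtype.ext h
                    rw [this, SimpleGraph.dist_self]
                    exact Nat.zero_le _
                  -- The vertex `r'` is not in `s`, so the maximality of `a` does not cover it; but
                  -- it has distance one, the least possible away from `r`.
                  · have : (⟨z, hzV⟩ : V) = r' := Subtype.ext h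
                    rw [this, SimpleGraph.dist_eq_one_iff_adj.2 hrr']
                    exact hG.connected.pos_dist_of_ne har.symm
                have hlt := lt_of_le_of_ne hle (hG.dist_ne_of_adj r hadj).symm
                exact congrArg Subtype.val (eq_of_adj_of_dist_lt hG hadj hvw hlt hdw)
            · exfalso
              have hq : (q : σ) ∈ (Finsupp.single a 1 + m).support := by rw [h]; simp
              have h1 := hms hq
              rw [Finset.coe_insert, Set.insert_union] at h1
              rcases h1 with h1 | h1 | h1 | h1
              · exact q.2 (h1 ▸ haV)
              · have h2 := hmax q h1
                have h3 := hM ⟨a, haV⟩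
                rw [hrankQ q q.2, show rank a = _ from hrankV ⟨a, haV⟩] at h2
                omega
              · exact q.2 (h1 ▸ r.2)
              · exact q.2 (h1 ▸ r'.2)
          · intro hm
            refine ⟨Or.inl ⟨s(⟨a, haV⟩, w), hvw, fun z hz => ?_⟩, hsupp m fun z hz => ?_⟩
            · rcases Finset.mem_union.1 (Finsupp.support_add hz) with h | h
              · rw [Finset.mem_singleton.1 (Finsupp.support_single_subset h), endpoints_mk]
                exact Or.inl rfl
              · exact hm h
            · have h1 := hm hz
              rw [endpoints_mk] at h1
              rcases h1 with rfl | h1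
              · exact Or.inl (by simp)
              · rw [h1]
                exact hcl.1 ⟨a, haV⟩ w (by simp) hvw hdw
        refine ConeChain.step _ a _ _ ⟨s(⟨a, haV⟩, w), hvw, rfl⟩ hlowL hT ?_
        rw [hL0]
        exact ih hr.2 hr'.2 hcls
      · have hT : ∀ m : σ →₀ ℕ, Finsupp.single a 1 + m ∈ Lof (insert a s) ↔
            (m.support : Set σ) ⊆ endpoints (φ ⟨a, haV⟩ : Sym2 V) := by
          intro m
          constructor
          · exact fun h => (single_add_mem_treeExponents ⟨a, haV⟩).1 h.1
          · intro hm
            exact ⟨(single_add_mem_treeExponents ⟨a, haV⟩).2 hm,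
              hsupp m (hm.trans (hcl.2 ⟨a, haV⟩ (by simp)))⟩
        refine ConeChain.step _ a _ _ ⟨_, (φ ⟨a, haV⟩).2, rfl⟩ hlowL hT ?_
        rw [hL0]
        exact ih hr.2 hr'.2 hcls
  set s₀ : Finset σ := Finset.univ \ {(r : σ), (r' : σ)} with hs₀
  have huniv : ∀ z, z ∈ (s₀ : Set σ) ∪ {(r : σ), (r' : σ)} := by
    intro z
    by_cases hz : z ∈ ({(r : σ), (r' : σ)} : Set σ)
    · exact Or.inr hz
    · left
      simpa [hs₀] using hz
  refine ⟨s₀.card, ?_, ?_⟩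
  · rw [Nat.card_eq_fintype_card, ← Finset.card_univ, ← Finset.card_pair hne]
    exact Finset.card_sdiff_add_card_eq_card (Finset.subset_univ _)
  · have h := main s₀ (by simp [hs₀]) (by simp [hs₀])
      ⟨fun _ w _ _ _ => huniv w, fun _ _ z _ => huniv z⟩
    have hL : Lof s₀ = treeExponents G φ := by
      ext m
      exact ⟨fun h => h.1, fun h => ⟨h, fun z _ => huniv z⟩⟩
    rwa [hL] at h

end

/-! ### Hilbert function and regular pairs along a chain of cones. -/

section

lemma standardCount_pair {σ : Type*} {x y : σ} (hxy : x ≠ y) (i : ℕ) :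
    standardCount {m : σ →₀ ℕ | (m.support : Set σ) ⊆ {x, y}} i = i + 1 := by
  classical
  let f : ℕ → σ →₀ ℕ := fun j => Finsupp.single x j + Finsupp.single y (i - j)
  have hf : Function.Injective f := by
    intro j j' h
    have := DFunLike.congr_fun h x
    simpa [f, hxy.symm] using this
  have : {m : σ →₀ ℕ | m ∈ {m : σ →₀ ℕ | (m.support : Set σ) ⊆ {x, y}} ∧ m.degree = i} =
      f '' (Finset.range (i + 1) : Finset ℕ) := by
    ext m
    constructor
    · rintro ⟨hm, hi⟩
      have hm' : m = Finsupp.single x (m x) + Finsupp.single y (m y) := by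
        ext z
        by_cases hzx : z = x
        · subst hzx; simp [hxy.symm]
        · by_cases hzy : z = y
          · subst hzy; simp [hxy]
          · have : m z = 0 := by
              by_contra h
              rcases hm (Finsupp.mem_support_iff.2 h) with h | h
              exacts [hzx h, hzy h]
            simp [this, Ne.symm hzx, Ne.symm hzy]
      have hd : m x + m y = i := by
        rw [hm', map_add, Finsupp.degree_single, Finsupp.degree_single] at hi
        exact hi
      refine ⟨m x, by simp; omega, ?_⟩
      conv_rhs => rw [hm']
      simp only [f]
      congr 2
      omega
    · rintro ⟨j, hj, rfl⟩
      have hj' : j < i + 1 := by simpa using hj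
      refine ⟨fun z hz => ?_, ?_⟩
      · rcases Finset.mem_union.1 (Finsupp.support_add hz) with h | h
        · exact Or.inl (Finset.mem_singleton.1 (Finsupp.support_single_subset h))
        · exact Or.inr (Finset.mem_singleton.1 (Finsupp.support_single_subset h))
      · simp only [f, map_add, Finsupp.degree_single]
        omega
  rw [standardCount, this, Set.ncard_image_of_injective _ hf, Set.ncard_coe_finset,
    Finset.card_range]

/-- A plane has `i + 1` monomials of degree `i`; a plane shifted by one degree has `i`, also for `i
= 0`. -/
lemma ConeChain.standardCount_eq {σ : Type*} [Finite σ] {F : Set (Set σ)}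
    (hF : ∀ T ∈ F, ∃ x y, x ≠ y ∧ T = {x, y}) {L : Set (σ →₀ ℕ)} {k : ℕ} (h : ConeChain F L k)
    (i : ℕ) : standardCount L i = i + 1 + k * i := by
  induction h with
  | base T hT =>
    obtain ⟨x, y, hxy, rfl⟩ := hF T hT
    rw [standardCount_pair hxy]
    simp
  | step L a T k hT hL ha h ih =>
    obtain ⟨x, y, hxy, hTxy⟩ := hF T hT
    cases i with
    | zero =>
      rw [standardCount] at ih ⊢
      convert ih using 2
      · ext m
        constructor
        · rintro ⟨h1, h2⟩
          exact ⟨⟨h1, by rw [(Finsupp.degree_eq_zero_iff m).1 h2]; rfl⟩, h2⟩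
        · exact fun h => ⟨h.1.1, h.2⟩
      · simp
    | succ j =>
      have hunion : {m | m ∈ L ∧ m.degree = j + 1} =
          {m | m ∈ {m | m ∈ L ∧ m a = 0} ∧ m.degree = j + 1} ∪
          (fun m => Finsupp.single a 1 + m) ''
            {m | m ∈ {m : σ →₀ ℕ | (m.support : Set σ) ⊆ T} ∧ m.degree = j} := by
        ext m
        constructor
        · rintro ⟨h1, h2⟩
          by_cases hma : m a = 0
          · exact Or.inl ⟨⟨h1, hma⟩, h2⟩
          · obtain ⟨m', rfl⟩ := exists_add_of_le
              (Finsupp.single_le_iff.2 (Nat.one_le_iff_ne_zero.2 hma))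
            refine Or.inr ⟨m', ⟨(ha m').1 h1, ?_⟩, rfl⟩
            rw [map_add, Finsupp.degree_single] at h2
            omega
        · rintro (h | ⟨m', ⟨h1, h2⟩, rfl⟩)
          · exact ⟨h.1.1, h.2⟩
          · refine ⟨(ha m').2 h1, ?_⟩
            simp only [map_add, Finsupp.degree_single, h2]
            omega
      rw [standardCount, hunion, Set.ncard_union_eq _
        ((finite_degree_eq (j + 1)).subset fun m hm => hm.2)
        (((finite_degree_eq j).subset fun m hm => hm.2).image _),
        Set.ncard_image_of_injective _ (add_right_injective _)]
      · change standardCount _ _ + standardCount {m : σ →₀ ℕ | (m.support : Set σ) ⊆ T} j = _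
        rw [ih, hTxy, standardCount_pair hxy]
        ring
      · rw [Set.disjoint_left]
        rintro _ h1 ⟨m', _, rfl⟩
        have := h1.1.2
        simp at this

/-- `f`, `g` form a weakly regular sequence on `S/J`, expressed in terms of elements of `S`. -/
def IsRegularPair {S : Type*} [CommRing S] (J : Ideal S) (f g : S) : Prop :=
  (∀ s, f * s ∈ J → s ∈ J) ∧ ∀ s u, g * s - f * u ∈ J → ∃ v, s - f * v ∈ J

/-- Weakly regular sequences pass to the middle term of `0 → S/(J:z) → S/J → S/(J+(z)) → 0`. -/
lemma IsRegularPair.extend {S : Type*} [CommRing S] {J J' P : Ideal S} {f g z : S}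
    (hP : ∀ s, z * s ∈ J ↔ s ∈ P) (hJ : J ≤ J')
    (hJ' : ∀ s ∈ J', ∃ t, s - z * t ∈ J) (h : IsRegularPair P f g) (h' : IsRegularPair J' f g) :
    IsRegularPair J f g := by
  constructor
  · intro s hs
    obtain ⟨t, ht⟩ := hJ' s (h'.1 s (hJ hs))
    have h1 : f * t ∈ P := by
      rw [← hP]
      have : z * (f * t) = f * s - f * (s - z * t) := by ring
      rw [this]
      exact J.sub_mem hs (J.mul_mem_left _ ht)
    have h2 := J.add_mem ht ((hP t).2 (h.1 t h1))
    rwa [sub_add_cancel] at h2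
  · intro s u hsu
    obtain ⟨v, hv⟩ := h'.2 s u (hJ hsu)
    obtain ⟨t, ht⟩ := hJ' _ hv
    have h1 : f * (g * v - u) ∈ J' := by
      have : f * (g * v - u) = (g * s - f * u) - g * (s - f * v) := by ring
      rw [this]
      exact J'.sub_mem (hJ hsu) (J'.mul_mem_left _ hv)
    obtain ⟨w, hw⟩ := hJ' _ (h'.1 _ h1)
    obtain ⟨t', ht'⟩ := h.2 t (-w) (by
      rw [← hP]
      have : z * (g * t - f * -w) = (g * s - f * u) - g * (s - f * v - z * t) -
        f * (g * v - u - z * w) := by ring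
      rw [this]
      exact J.sub_mem (J.sub_mem hsu (J.mul_mem_left _ ht)) (J.mul_mem_left _ hw))
    refine ⟨v + z * t', ?_⟩
    have : s - f * (v + z * t') = (s - f * v - z * t) + z * (t - f * t') := by ring
    rw [this]
    exact J.add_mem ht ((hP _).2 ht')

lemma IsRegularPair.isWeaklyRegular {S : Type*} [CommRing S] {J : Ideal S} {f g : S}
    (h : IsRegularPair J f g) : RingTheory.Sequence.IsWeaklyRegular (S ⧸ J)
      [Ideal.Quotient.mk J f, Ideal.Quotient.mk J g] := by
  have hq : ∀ u : S ⧸ J,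
      (Submodule.Quotient.mk u : QuotSMulTop (Ideal.Quotient.mk J f) (S ⧸ J)) = 0 ↔
      Ideal.Quotient.mk J f ∣ u := by
    intro u
    rw [Submodule.Quotient.mk_eq_zero, Submodule.mem_smul_pointwise_iff_exists]
    constructor
    · rintro ⟨v, _, rfl⟩
      exact ⟨v, rfl⟩
    · rintro ⟨v, rfl⟩
      exact ⟨v, trivial, rfl⟩
  rw [RingTheory.Sequence.isWeaklyRegular_cons_iff, RingTheory.Sequence.isWeaklyRegular_cons_iff]
  refine ⟨?_, ?_, RingTheory.Sequence.IsWeaklyRegular.nil _ _⟩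
  · rw [isSMulRegular_iff_right_eq_zero_of_smul]
    intro u hu
    obtain ⟨s, rfl⟩ := Ideal.Quotient.mk_surjective u
    rw [smul_eq_mul, ← map_mul, Ideal.Quotient.eq_zero_iff_mem] at hu
    exact Ideal.Quotient.eq_zero_iff_mem.2 (h.1 s hu)
  · rw [isSMulRegular_iff_right_eq_zero_of_smul]
    intro u hu
    obtain ⟨u, rfl⟩ := Submodule.Quotient.mk_surjective _ u
    obtain ⟨s, rfl⟩ := Ideal.Quotient.mk_surjective u
    rw [← Submodule.Quotient.mk_smul, hq] at hu
    obtain ⟨w, hw⟩ := hu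
    obtain ⟨w, rfl⟩ := Ideal.Quotient.mk_surjective w
    rw [smul_eq_mul, ← map_mul, ← map_mul, Ideal.Quotient.mk_eq_mk_iff_sub_mem] at hw
    obtain ⟨v, hv⟩ := h.2 s w hw
    rw [hq]
    refine ⟨Ideal.Quotient.mk J v, ?_⟩
    rw [← map_mul, Ideal.Quotient.mk_eq_mk_iff_sub_mem]
    exact hv

variable {σ K : Type*} [Field K]

variable (K) in
/-- The monomial ideal generated by the monomials with exponents outside `L`. -/
def lowerIdeal (L : Set (σ →₀ ℕ)) : Ideal (MvPolynomial σ K) :=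
  Ideal.span ((fun a => monomial a (1 : K)) '' Lᶜ)

lemma isMonomialIdeal_lowerIdeal (L : Set (σ →₀ ℕ)) : IsMonomialIdeal (lowerIdeal K L) :=
  ⟨_, rfl⟩

lemma standardExponents_lowerIdeal {L : Set (σ →₀ ℕ)} (hL : IsLowerSet L) :
    standardExponents (lowerIdeal K L) = L := by
  classical
  ext m
  rw [standardExponents, Set.mem_ofPred_eq, lowerIdeal, mem_ideal_span_monomial_image]
  simp only [support_monomial, one_ne_zero, if_false, Finset.mem_singleton, forall_eq,
    Set.mem_compl_iff, not_exists, not_and]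
  constructor
  · intro h
    by_contra hm
    exact h m hm le_rfl
  · exact fun hm a ha ham => ha (hL ham hm)

lemma mem_lowerIdeal {L : Set (σ →₀ ℕ)} (hL : IsLowerSet L) {s : MvPolynomial σ K} :
    s ∈ lowerIdeal K L ↔ ∀ m ∈ s.support, m ∉ L := by
  rw [(isMonomialIdeal_lowerIdeal L).mem_iff, standardExponents_lowerIdeal hL]

lemma ConeChain.isRegularPair {F : Set (Set σ)} {f g : MvPolynomial σ K}
    (hF : ∀ T ∈ F, IsRegularPair (RingHom.ker (restrictVars K T)) f g) {L : Set (σ →₀ ℕ)} {k : ℕ}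
    (h : ConeChain F L k) : IsRegularPair (lowerIdeal K L) f g := by
  induction h with
  | base T hT =>
    have hlow : IsLowerSet {m : σ →₀ ℕ | (m.support : Set σ) ⊆ T} :=
      fun m m' hle hm z hz => hm (Finsupp.support_mono hle hz)
    have : lowerIdeal K {m : σ →₀ ℕ | (m.support : Set σ) ⊆ T} =
        RingHom.ker (restrictVars K T) := by
      ext s
      rw [mem_lowerIdeal hlow, mem_ker_restrictVars]
      refine forall_congr' fun m => ?_
      rw [mem_support_iff]
      exact not_imp_not
    rw [this]
    exact hF T hT
  | step L a T k hT hL ha h ih =>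
    have hL' : IsLowerSet {m | m ∈ L ∧ m a = 0} := fun m m' hle hm =>
      ⟨hL hle hm.1, Nat.eq_zero_of_le_zero (hm.2 ▸ hle a)⟩
    -- The colon ideal of `x_a` is the prime of the plane `T`, and adding `x_a` to the ideal gives
    -- the previous member of the chain.
    refine IsRegularPair.extend (z := X a) (fun s => ?_) (fun s hs => ?_) (fun s hs => ?_)
      (hF T hT) ih
    · rw [X, (isMonomialIdeal_lowerIdeal L).monomial_mul_mem_iff,
        standardExponents_lowerIdeal hL, mem_ker_restrictVars]
      refine forall_congr' fun m => ?_
      rw [ha, mem_support_iff]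
      exact not_imp_not
    · rw [mem_lowerIdeal hL] at hs
      rw [mem_lowerIdeal hL']
      exact fun m hm h => hs m hm h.1
    · rw [mem_lowerIdeal hL'] at hs
      suffices s ∈ lowerIdeal K L ⊔ Ideal.span {X a} by
        obtain ⟨j, hj, z, hz, rfl⟩ := Submodule.mem_sup.1 this
        obtain ⟨t, rfl⟩ := Ideal.mem_span_singleton.1 hz
        exact ⟨t, by simpa using hj⟩
      rw [s.as_sum]
      refine Ideal.sum_mem _ fun m hm => ?_
      by_cases hmL : m ∈ L
      · have hma : m a ≠ 0 := fun h => hs m hm ⟨hmL, h⟩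
        exact Ideal.mem_sup_right (monomial_mem_of_le
          (Finsupp.single_le_iff.2 (Nat.one_le_iff_ne_zero.2 hma))
          (Ideal.subset_span (Set.mem_singleton _)) _)
      · exact Ideal.mem_sup_left (monomial_mem_of_le le_rfl (Ideal.subset_span
          (Set.mem_image_of_mem (fun a => monomial a (1 : K)) hmL)) _)

lemma aeval_X_ne_zero (x : σ) {p : Polynomial K} (hp : p ≠ 0) :
    Polynomial.aeval (X x : MvPolynomial σ K) p ≠ 0 :=
  fun h => hp (transcendental_iff.1 (transcendental_X K x) p h)

lemma degreeOf_aeval_X {x z : σ} (hz : z ≠ x) (p : Polynomial K) :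
    degreeOf z (Polynomial.aeval (X x : MvPolynomial σ K) p) = 0 := by
  have h : Polynomial.aeval (X x : MvPolynomial σ K) p ∈ supported K {x} := by
    rw [supported, Set.image_singleton]
    exact Polynomial.aeval_mem_adjoin_singleton K _
  rw [mem_supported] at h
  by_contra hd
  exact hz (h (mem_vars_iff_degreeOf_ne_zero.2 hd))

/-- Polynomials in different variables are coprime. -/
lemma isRelPrime_aeval_X {x y : σ} (hxy : x ≠ y) {p q : Polynomial K} (hp : p ≠ 0) (hq : q ≠ 0) :
    IsRelPrime (Polynomial.aeval (X x : MvPolynomial σ K) p)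
      (Polynomial.aeval (X y : MvPolynomial σ K) q) := by
  rintro d ⟨u, hu⟩ ⟨v, hv⟩
  have hp' := aeval_X_ne_zero x hp
  have hq' := aeval_X_ne_zero y hq
  have hd : d ≠ 0 := by
    rintro rfl
    exact hp' (by rw [hu, zero_mul])
  have hdeg : ∀ z, degreeOf z d = 0 := by
    intro z
    by_cases hz : z = x
    · have h := degreeOf_aeval_X (hz ▸ hxy) q
      rw [hv, degreeOf_mul_eq hd (by rintro rfl; exact hq' (by rw [hv, mul_zero]))] at h
      omega
    · have h := degreeOf_aeval_X hz p
      rw [hu, degreeOf_mul_eq hd (by rintro rfl; exact hp' (by rw [hu, mul_zero]))] at h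
      omega
  have hmem : d ∈ supported K (∅ : Set σ) := by
    rw [mem_supported]
    exact fun z hz => (mem_vars_iff_degreeOf_ne_zero.1 hz (hdeg z)).elim
  rw [supported_empty] at hmem
  obtain ⟨c, rfl⟩ := Algebra.mem_bot.1 hmem
  exact (IsUnit.mk0 c (by rintro rfl; exact hd (map_zero _))).map _

/-- On the plane of `x, y` the two elements become `p(x)` and `q(y)`, which are nonzero and coprime,
hence a weakly regular pair. -/
lemma isRegularPair_ker_restrictVars {x y : σ} (hxy : x ≠ y) {p q : Polynomial K} (hp : p ≠ 0)
    (hq : q ≠ 0) {θ₀ θ₁ : MvPolynomial σ K} (h₀ : restrictVars K {x, y} θ₀ = X x)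
    (h₁ : restrictVars K {x, y} θ₁ = X y) :
    IsRegularPair (RingHom.ker (restrictVars K {x, y})) (Polynomial.aeval θ₀ p)
      (Polynomial.aeval θ₁ q) := by
  set ρ := restrictVars K ({x, y} : Set σ) with hρ
  have hf : ρ (Polynomial.aeval θ₀ p) = Polynomial.aeval (X x) p := by
    rw [← Polynomial.aeval_algHom_apply, h₀]
  have hg : ρ (Polynomial.aeval θ₁ q) = Polynomial.aeval (X y) q := by
    rw [← Polynomial.aeval_algHom_apply, h₁]
  have hidem : ∀ s, ρ (ρ s) = ρ s := by
    classical
    intro s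
    ext m
    simp only [hρ, coeff_restrictVars]
    split_ifs <;> rfl
  constructor
  · intro s hs
    rw [RingHom.mem_ker, map_mul, hf] at hs
    exact (mul_eq_zero.1 hs).resolve_left (aeval_X_ne_zero x hp)
  · intro s u hsu
    rw [RingHom.mem_ker, map_sub, map_mul, map_mul, hf, hg, sub_eq_zero] at hsu
    have hdvd : Polynomial.aeval (X x) p ∣ ρ s :=
      (isRelPrime_aeval_X hxy hp hq).dvd_of_dvd_mul_left ⟨ρ u, hsu⟩
    obtain ⟨w, hw⟩ := hdvd
    refine ⟨w, ?_⟩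
    rw [RingHom.mem_ker, map_sub, map_mul, hf, ← hidem s, hw, map_mul, ← hf, hidem, sub_self]

end

/-! ### Cohen-Macaulayness at every maximal ideal, and the passage from the tree to the ring. -/

section

variable {σ K : Type*} [Field K]

open Classical in
variable (K) in
/-- The sum of the variables of a given color. -/
def colorSum [Fintype σ] (color : σ → ℕ) (c : ℕ) : MvPolynomial σ K :=
  ∑ z, if color z = c then X z else 0

lemma restrictVars_colorSum [Fintype σ] {color : σ → ℕ} {c : ℕ} {x y : σ} (hx : color x = c)
    (hy : color y ≠ c) : restrictVars K {x, y} (colorSum K color c) = X x := by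
  classical
  rw [colorSum, map_sum, Finset.sum_eq_single x]
  · rw [if_pos hx, restrictVars_X, if_pos (by simp)]
  · intro z _ hzx
    split_ifs with hz
    · rw [restrictVars_X, if_neg]
      rintro (rfl | rfl)
      exacts [hzx rfl, hy hz]
    · exact map_zero _
  · exact fun h => (h (Finset.mem_univ x)).elim

/-- By the Nullstellensatz the residue field is finite over `K`, so the minimal polynomial of the
residue of `θ` serves, whatever the field. -/
lemma exists_ne_zero_aeval_mem (I : Ideal (MvPolynomial σ K)) [Finite σ]
    (p : Ideal (MvPolynomial σ K ⧸ I)) [hp : p.IsMaximal] (θ : MvPolynomial σ K) :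
    ∃ f : Polynomial K, f ≠ 0 ∧ Ideal.Quotient.mk I (Polynomial.aeval θ f) ∈ p := by
  let _ := Ideal.Quotient.field p
  have : Module.Finite K ((MvPolynomial σ K ⧸ I) ⧸ p) :=
    finite_of_finite_type_of_isJacobsonRing K _
  let π : MvPolynomial σ K →ₐ[K] (MvPolynomial σ K ⧸ I) ⧸ p :=
    (Ideal.Quotient.mkₐ K p).comp (Ideal.Quotient.mkₐ K I)
  have hint : IsIntegral K (π θ) := IsIntegral.of_finite K _
  refine ⟨minpoly K (π θ), minpoly.ne_zero hint, ?_⟩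
  rw [← Ideal.Quotient.eq_zero_iff_mem]
  change π (Polynomial.aeval θ (minpoly K (π θ))) = 0
  rw [← Polynomial.aeval_algHom_apply, minpoly.aeval]

lemma length_le_ringKrullDim {A : Type*} [CommRing A] [IsNoetherianRing A] [IsLocalRing A]
    {rs : List A} (h : RingTheory.Sequence.IsRegular A rs) :
    ((rs.length : ℕ) : WithBot ℕ∞) ≤ ringKrullDim A := by
  have hnt : Nontrivial (A ⧸ Ideal.ofList rs) := by
    refine Ideal.Quotient.nontrivial_iff.2 fun h' => h.top_ne_smul ?_
    rw [h', smul_eq_mul, Ideal.top_mul]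
  rw [← ringKrullDim_add_length_eq_ringKrullDim_of_isRegular rs h]
  exact le_add_of_nonneg_left ringKrullDim_nonneg_of_nontrivial

/-- Away from the origin `θ₀, θ₁` need not lie in the maximal ideal, but nonzero polynomials in them
do. These give a regular sequence of length two, and the dimension is at most two. -/
lemma isCohenMacaulay_of_exists_isRegularPair [Finite σ] (I : Ideal (MvPolynomial σ K))
    (hdim : ringKrullDim (MvPolynomial σ K ⧸ I) ≤ 2) (θ₀ θ₁ : MvPolynomial σ K)
    (h : ∀ p q : Polynomial K, p ≠ 0 → q ≠ 0 →
      IsRegularPair I (Polynomial.aeval θ₀ p) (Polynomial.aeval θ₁ q)) :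
    IsCohenMacaulay (MvPolynomial σ K ⧸ I) := by
  refine ⟨inferInstance, fun p hp => ?_⟩
  obtain ⟨f, hf, hfp⟩ := exists_ne_zero_aeval_mem I p θ₀
  obtain ⟨g, hg, hgp⟩ := exists_ne_zero_aeval_mem I p θ₁
  have hreg := (h f g hf hg).isWeaklyRegular.isRegular_of_isLocalization_of_mem
    (Localization.AtPrime p) p (by
      intro r hr
      simp only [List.mem_cons, List.not_mem_nil, or_false] at hr
      rcases hr with rfl | rfl
      exacts [hfp, hgp])
  refine ⟨_, ?_, hreg, ?_⟩
  · intro r hr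
    obtain ⟨s, hs, rfl⟩ := List.mem_map.1 hr
    simp only [List.mem_cons, List.not_mem_nil, or_false] at hs
    rw [IsLocalization.AtPrime.to_map_mem_maximal_iff (Localization.AtPrime p) p]
    rcases hs with rfl | rfl
    exacts [hfp, hgp]
  · refine le_antisymm ?_ ?_
    · exact length_le_ringKrullDim hreg
    · rw [IsLocalization.AtPrime.ringKrullDim_eq_height p (Localization.AtPrime p)]
      exact Ideal.height_le_ringKrullDim_of_isPrime.trans hdim

/-- The summands `i + 1` and `c i` are the coefficients of `1/(1-z)^2` and `c z/(1-z)^2`. -/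
lemma hilbertSeries_mul_one_sub_X_sq {F : PowerSeries ℤ} {c : ℕ}
    (hF : ∀ i, PowerSeries.coeff i F = i + 1 + c * i) :
    F * (1 - PowerSeries.X) ^ 2 =
      ((1 + Polynomial.C (c : ℤ) * Polynomial.X : Polynomial ℤ) : PowerSeries ℤ) := by
  have h0 : ∀ G : PowerSeries ℤ, PowerSeries.coeff 0 (G * (1 - PowerSeries.X)) =
      PowerSeries.coeff 0 G := fun G => by
    rw [mul_sub, mul_one, map_sub, PowerSeries.coeff_zero_mul_X, sub_zero]
  rw [pow_two, ← mul_assoc]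
  ext n
  rw [Polynomial.coeff_coe, Polynomial.coeff_add, Polynomial.coeff_C_mul]
  rcases n with _ | _ | n
  · rw [h0, h0, hF]
    simp
  · rw [coeff_mul_one_sub_X_succ, h0, coeff_mul_one_sub_X_succ, hF, hF]
    simp [Polynomial.coeff_one]
    ring
  · rw [coeff_mul_one_sub_X_succ, coeff_mul_one_sub_X_succ, coeff_mul_one_sub_X_succ, hF, hF, hF]
    simp [Polynomial.coeff_one, Polynomial.coeff_X]
    ring

/-- The quotient by the ideal of a tree is Cohen-Macaulay of dimension two with minimal
multiplicity. -/
theorem treeIdeal_properties [Finite σ] {V : Set σ} {G : SimpleGraph V} (hG : G.IsTree)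
    (hE : G.edgeSet.Nonempty) (φ : (Vᶜ : Set σ) → G.edgeSet) :
    ringKrullDim (MvPolynomial σ K ⧸ treeIdeal K G φ) = 2 ∧
      IsCohenMacaulay (MvPolynomial σ K ⧸ treeIdeal K G φ) ∧
      HasMinimalMultiplicity (treeIdeal K G φ) := by
  classical
  have := Fintype.ofFinite σ
  have hI := isMonomialIdeal_treeIdeal K G φ
  obtain ⟨k, hk, hchain⟩ := coneChain_treeExponents hG hE φ
  have hV : Nontrivial V := by
    obtain ⟨e, he⟩ := hE
    induction e with
    | h x y => exact ⟨x, y, SimpleGraph.Adj.ne he⟩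
  have hneigh : ∀ x, ∃ y, G.Adj x y := fun x => hG.connected.preconnected.exists_adj_of_nontrivial x
  have hstd := standardExponents_treeIdeal K G φ hneigh hE
  have hlow := isLowerSet_treeExponents G φ hneigh hE
  have hdim : ringKrullDim (MvPolynomial σ K ⧸ treeIdeal K G φ) = 2 := by
    apply le_antisymm
    · refine ringKrullDim_quotient_le_of_forall_prime _ 2 fun p hp hIp => ?_
      set W := {x | X x ∉ p} with hW
      -- The product of the squares of the variables outside `p` is not in `p`, hence standard.
      -- Squares exclude a factor from `Q`, whose exponent would be exactly one, so `W` lies in an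
      -- edge.
      have hm : Finsupp.equivFunOnFinite.symm (fun z => if z ∈ W then 2 else 0) ∈
          treeExponents G φ := by
        rw [← hstd]
        intro h
        obtain ⟨z, hz, hzp⟩ := exists_mem_support_of_monomial_mem (hIp h)
        rw [Finsupp.mem_support_iff, Finsupp.equivFunOnFinite_symm_apply_apply] at hz
        exact hz (if_neg (fun h => h hzp))
      rcases hm with ⟨e, he, hm⟩ | ⟨q, m', hm', h⟩
      · have hsub : W ⊆ endpoints e := fun z hz => hm (by
          rw [Finset.mem_coe, Finsupp.mem_support_iff, Finsupp.equivFunOnFinite_symm_apply_apply,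
            if_pos hz]
          exact two_ne_zero)
        refine (Set.ncard_le_ncard hsub (Set.toFinite _)).trans ?_
        induction e with
        | h x y =>
          rw [endpoints_mk]
          exact Set.ncard_insert_le _ _ |>.trans (by simp)
      · exfalso
        have hq : m' q = 0 := by
          by_contra hs
          exact q.2 (endpoints_subset _ (hm' (Finsupp.mem_support_iff.2 hs)))
        have h1 := DFunLike.congr_fun h (q : σ)
        rw [Finsupp.equivFunOnFinite_symm_apply_apply, Finsupp.add_apply, hq,
          Finsupp.single_eq_same] at h1
        split_ifs at h1 <;> omega
    · obtain ⟨e, he⟩ := hE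
      induction e with
      | h x y =>
        have hne : (x : σ) ≠ y := fun h => SimpleGraph.Adj.ne he (Subtype.ext h)
        have := le_ringKrullDim_quotient hI {(x : σ), (y : σ)} fun m hm => by
          rw [hstd]
          refine Or.inl ⟨s(x, y), he, ?_⟩
          rw [endpoints_mk]
          exact fun z hz => by simpa using hm hz
        rw [Finset.card_pair hne] at this
        exact_mod_cast this
  obtain ⟨r⟩ := hG.connected.nonempty
  -- The bipartition of the tree by parity of the distance to `r`; the third colour keeps `Q` out of
  -- both sums.
  let color : σ → ℕ := fun z => if h : z ∈ V then G.dist r ⟨z, h⟩ % 2 else 2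
  have hF : ∀ T ∈ {T | ∃ e ∈ G.edgeSet, T = endpoints e}, ∃ x y, x ≠ y ∧ T = {x, y} ∧
      color x = 0 ∧ color y = 1 := by
    rintro _ ⟨e, he, rfl⟩
    induction e with
    | h x y =>
      have hadj : G.Adj x y := he
      have hne : (x : σ) ≠ y := fun h => hadj.ne (Subtype.ext h)
      have hx : color x = G.dist r x % 2 := dif_pos x.2
      have hy : color y = G.dist r y % 2 := dif_pos y.2
      have h1 := hG.dist_eq_dist_add_one_of_adj r hadj
      rcases Nat.mod_two_eq_zero_or_one (G.dist r x) with h | h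
      · exact ⟨x, y, hne, endpoints_mk x y, by omega, by omega⟩
      · exact ⟨y, x, hne.symm, by rw [endpoints_mk, Set.pair_comm], by omega, by omega⟩
  refine ⟨hdim, ?_, fun f hf h1 => hI.eq_zero_of_isHomogeneous_one (fun z => ?_) hf h1, k, ?_,
    1 + Polynomial.C (k : ℤ) * Polynomial.X, ⟨2, hdim, ?_⟩, ?_⟩
  · refine isCohenMacaulay_of_exists_isRegularPair _ hdim.le (colorSum K color 0)
      (colorSum K color 1) fun p q hp hq => ?_
    have hIL : treeIdeal K G φ = lowerIdeal K (treeExponents G φ) :=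
      hI.ext (isMonomialIdeal_lowerIdeal _) (by rw [hstd, standardExponents_lowerIdeal hlow])
    rw [hIL]
    refine hchain.isRegularPair fun T hT => ?_
    obtain ⟨x, y, hxy, rfl, hx, hy⟩ := hF T hT
    refine isRegularPair_ker_restrictVars hxy hp hq (restrictVars_colorSum hx (by omega)) ?_
    rw [Set.pair_comm]
    exact restrictVars_colorSum hy (by omega)
  · rw [hstd]
    by_cases hz : z ∈ V
    · obtain ⟨w, hw⟩ := hneigh ⟨z, hz⟩
      refine Or.inl ⟨s(⟨z, hz⟩, w), hw, fun x hx => ?_⟩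
      rw [endpoints_mk]
      exact Or.inl (Finset.mem_singleton.1 (Finsupp.support_single_subset hx))
    · exact Or.inr ⟨⟨z, hz⟩, 0, by simp, by simp⟩
  · rw [HasCodimension, hdim, MvPolynomial.ringKrullDim_of_isNoetherianRing,
      ringKrullDim_eq_zero_of_field, zero_add, ← hk, add_comm k 2]
    rfl
  · refine hilbertSeries_mul_one_sub_X_sq fun i => ?_
    rw [hI.hilbertSeries_eq, PowerSeries.coeff_mk, hstd, hchain.standardCount_eq (fun T hT => by
      obtain ⟨x, y, hxy, hT, _⟩ := hF T hT
      exact ⟨x, y, hxy, hT⟩)]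
    push_cast
    rfl
  · simp [add_comm]

end

end MonomialTrees

end

theorem mainTheorem5 {σ : Type*} [Finite σ] {K : Type*} [Field K]
    (I : Ideal (MvPolynomial σ K)) (hI : MonomialTrees.IsMonomialIdeal I) :
    (∃ (V : Set σ) (G : SimpleGraph V) (φ : (Vᶜ : Set σ) → G.edgeSet),
        G.IsTree ∧ G.edgeSet.Nonempty ∧ I = MonomialTrees.treeIdeal K G φ) ↔
      (ringKrullDim (MvPolynomial σ K ⧸ I) = 2 ∧
        MonomialTrees.IsCohenMacaulay (MvPolynomial σ K ⧸ I) ∧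
        MonomialTrees.HasMinimalMultiplicity I) := by
  constructor
  · rintro ⟨V, G, φ, hG, hE, rfl⟩
    exact MonomialTrees.treeIdeal_properties hG hE φ
  · rintro ⟨hdim, hCM, hmult⟩
    exact hI.exists_eq_treeIdeal hdim hCM hmult
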